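/- Let $H=\mathbb C((z^{-1}))=H_+\oplus H_-$ with $H_+=\mathbb C[z]$ and $H_-=z^{-1}\mathbb C[[z^{-1}]]$, equipped with the $z^{-1}$-adic topology, and let $\pi_+:H\to H_+$ be the projection along $H_-$. The big cell $\mathrm{Gr}^{(0)}_+$ of the Sato Grassmannian is the set of closed linear subspaces $\mathcal W\subset H$ for which $\pi_+|_{\mathcal W}:\mathcal W\to H_+$ has zero kernel and zero cokernel. Write $\partial_z=\frac{\partial}{\partial z}$ and let $\mathcal D=\mathbb C((z^{-1}))[[\partial_z]]$ be the ring of differential operators $\sum_{m\ge 0}a_m\partial_z^m$ with $a_m\in H$ whose degrees in $z$ are bounded above uniformly in $m$; it acts on $H$. Let $\mathcal D_-=H_-[[\partial_z]]\subset\mathcal D$ be the set of those operators with all $a_m\in H_-$. Every $\mathtt G\in 1+\mathcal D_-$ is invertible in $\mathcal D$, and for every $\mathcal W\in\mathrm{Gr}^{(0)}_+$ there is exactly one $\mathtt G_{\mathcal W}\in 1+\mathcal D_-$ with $\mathcal W=\mathtt G_{\mathcal W}\cdot H_+$ (Sato's group element). Put $$\rho(\mathcal W)=(\mathtt P_{\mathcal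 W},\mathtt Q_{\mathcal W})=\left(\mathtt G_{\mathcal W}\,\partial_z\,\mathtt G_{\mathcal W}^{-1},\ \mathtt G_{\mathcal W}\,z\,\mathtt G_{\mathcal W}^{-1}\right),$$ $$\mathrm{Gr}_{\mathcal D}=\left\{(\mathtt P,\mathtt Q)\in\mathcal D^2\ \middle|\ [\mathtt P,\mathtt Q]=1,\ \mathtt P-\partial_z\in z^{-1}\mathcal D_-,\ \mathtt Q-z\in\mathcal D_-\right\}.$$ Then $\rho$ is a bijection from $\mathrm{Gr}^{(0)}_+$ onto $\mathrm{Gr}_{\mathcal D}$. Its inverse is described as follows: for $(\mathtt P,\mathtt Q)\in\mathrm{Gr}_{\mathcal D}$ the equation $\mathtt P\cdot\Psi=0$ has a unique monic solution $\Psi\in H$ (monic: the coefficient of the highest power of $z$ occurring in $\Psi$ is $1$), the linear span $\mathrm{span}_{\mathbb C}\{\Psi,\mathtt Q\cdot\Psi,\mathtt Q^2\cdot\Psi,\dots\}$ belongs to $\mathrm{Gr}^{(0)}_+$, and $$\rho^{-1}(\mathtt P,\mathtt Q)=\mathrm{span}_{\mathbb C}\{\Psi,\mathtt Q\cdot\Psi,\mathtt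 Q^2\cdot\Psi,\dots\}.$$ -/

import Mathlib

noncomputable section

namespace SatoKS

open Polynomial

/-- The space `H = ℂ((z⁻¹))` of formal Laurent series in `z⁻¹`. The variable of `LaurentSeries`
stands for `z⁻¹`, so that the coefficient of `z ^ k` sits at the index `-k`; the topology is the
`z⁻¹`-adic one. -/
abbrev H : Type := LaurentSeries ℂ

/-- The coefficient of `z ^ k` in `f`. -/
def zCoeff (f : H) (k : ℤ) : ℂ := f.coeff (-k)

/-- The monomial `z ^ k`, for `k : ℤ`. -/
def zpow (k : ℤ) : H := HahnSeries.single (-k) (1 : ℂ)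

/-- A bounded-below coefficient function defines a Laurent series. -/
theorem bddBelow_of_zero {f : ℤ → ℂ} (L : ℤ) (h : ∀ n < L, f n = 0) :
    BddBelow (Function.support f) :=
  ⟨L, fun n hn => not_lt.mp fun hlt => hn (h n hlt)⟩

theorem exists_lower (f : H) : ∃ L : ℤ, ∀ n < L, f.coeff n = 0 := by
  by_cases hf : f = 0
  · exact ⟨0, fun n _ => by simp [hf]⟩
  · exact ⟨f.order, fun n hn => HahnSeries.coeff_eq_zero_of_lt_order hn⟩

/-- The derivation `∂ = d/dz` of `H`: the coefficient of `z ^ k` in `∂ f` is `k + 1` times the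
coefficient of `z ^ (k + 1)` in `f` (below `n = -k`). -/
def ddz : H →ₗ[ℂ] H where
  toFun f := HahnSeries.ofSuppBddBelow (fun n : ℤ => (1 - (n : ℂ)) * f.coeff (n - 1)) (by
    obtain ⟨L, hL⟩ := exists_lower f
    exact bddBelow_of_zero L fun n hn => by rw [hL _ (by omega), mul_zero])
  map_add' f g := by
    ext n; simp [mul_add]
  map_smul' c f := by
    ext n; simp; ring

theorem ddz_coeff (f : H) (n : ℤ) : (ddz f).coeff n = (1 - (n : ℂ)) * f.coeff (n - 1) := rfl

theorem zCoeff_ddz (f : H) (k : ℤ) : zCoeff (ddz f) k = ((k : ℂ) + 1) * zCoeff f (k + 1) := by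
  simp only [zCoeff, ddz_coeff, neg_add']
  push_cast; ring

theorem ddz_pow_coeff (m : ℕ) (f : H) (n : ℤ) :
    ((ddz ^ m) f).coeff n
      = (descPochhammer ℂ m).eval ((m : ℂ) - (n : ℂ)) * f.coeff (n - m) := by
  induction m generalizing n with
  | zero => simp
  | succ m ih =>
    rw [pow_succ', Module.End.mul_apply, ddz_coeff, ih, descPochhammer_succ_eval]
    have e1 : n - 1 - (m : ℤ) = n - ((m + 1 : ℕ) : ℤ) := by push_cast; ring
    have e2 : (m : ℂ) - ((n - 1 : ℤ) : ℂ) = ((m + 1 : ℕ) : ℂ) - (n : ℂ) := by push_cast; ring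
    rw [e1, e2]
    push_cast; ring

/-- The coefficient sequence `a` of `∑ₘ aₘ ∂ᵐ` has `z`-degrees bounded above by `N`, uniformly
in `m`. -/
def DegLE (a : ℕ → H) (N : ℤ) : Prop := ∀ m : ℕ, ∀ k : ℤ, N < k → zCoeff (a m) k = 0

theorem mul_coeff_finset {x y : H} {A B n : ℤ} (hx : ∀ k < A, x.coeff k = 0)
    (hy : ∀ k < B, y.coeff k = 0) :
    (x * y).coeff n = ∑ l ∈ Finset.Icc B (n - A), x.coeff (n - l) * y.coeff l := by
  rw [HahnSeries.coeff_mul]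
  refine Finset.sum_bij_ne_zero (fun ij _ _ => ij.2) ?_ ?_ ?_ ?_
  · intro ij h1 h2
    rw [Finset.mem_antidiagonal] at h1
    have h3 := left_ne_zero_of_mul h2
    have h4 := right_ne_zero_of_mul h2
    have h5 : A ≤ ij.1 := not_lt.mp fun h => h3 (hx _ h)
    have h6 : B ≤ ij.2 := not_lt.mp fun h => h4 (hy _ h)
    rw [Finset.mem_Icc]; omega
  · rintro ⟨i, j⟩ h1 _ ⟨i', j'⟩ h1' _ h
    rw [Finset.mem_antidiagonal] at h1 h1'
    simp only at h
    ext <;> simp <;> omega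
  · intro l _ h2
    refine ⟨(n - l, l), ?_, h2, rfl⟩
    rw [Finset.mem_antidiagonal]
    exact ⟨left_ne_zero_of_mul h2, right_ne_zero_of_mul h2, by simp⟩
  · intro ij h1 _
    rw [Finset.mem_antidiagonal] at h1
    rw [show n - ij.2 = ij.1 by omega]

theorem term_zero {a : ℕ → H} {N : ℤ} (ha : DegLE a N) {f : H} {L : ℤ}
    (hf : ∀ k < L, f.coeff k = 0) {n : ℤ} {m : ℕ} (h : n + N - L < m) :
    (a m * (ddz ^ m) f).coeff n = 0 := by
  rw [mul_coeff_finset (A := -N) (B := L + m) (n := n)]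
  · apply Finset.sum_eq_zero
    intro l hl
    rw [Finset.mem_Icc] at hl
    omega
  · intro k hk
    have := ha m (-k) (by omega)
    simpa [zCoeff] using this
  · intro k hk
    rw [ddz_pow_coeff, hf _ (by omega), mul_zero]

theorem term_zero' {a : ℕ → H} {N : ℤ} (ha : DegLE a N) {f : H} {L : ℤ}
    (hf : ∀ k < L, f.coeff k = 0) {n : ℤ} (m : ℕ) (h : n < L - N) :
    (a m * (ddz ^ m) f).coeff n = 0 :=
  term_zero ha hf (by omega)

theorem finite_terms {a : ℕ → H} (ha : ∃ N, DegLE a N) (f : H) (n : ℤ) :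
    (Function.support fun m : ℕ => (a m * (ddz ^ m) f).coeff n).Finite := by
  obtain ⟨N, hN⟩ := ha
  obtain ⟨L, hL⟩ := exists_lower f
  refine (Set.finite_Iic (n + N - L).toNat).subset fun m hm => ?_
  by_contra hlt
  rw [Set.mem_Iic] at hlt
  exact hm (term_zero hN hL (by omega))

theorem mul_smul_H (c : ℂ) (f g : H) : f * (c • g) = c • (f * g) := by
  rw [← HahnSeries.C_mul_eq_smul, ← HahnSeries.C_mul_eq_smul, mul_left_comm]

/-- The operator `f ↦ ∑ₘ aₘ · ∂ᵐ f` on `H`, for a coefficient sequence of bounded degree. Each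
coefficient of the result is a finite sum. -/
def seriesOp (a : ℕ → H) (ha : ∃ N, DegLE a N) : H →ₗ[ℂ] H where
  toFun f := HahnSeries.ofSuppBddBelow
    (fun n : ℤ => ∑ᶠ m : ℕ, (a m * (ddz ^ m) f).coeff n) (by
      obtain ⟨N, hN⟩ := ha
      obtain ⟨L, hL⟩ := exists_lower f
      exact bddBelow_of_zero (L - N) fun n hn =>
        finsum_eq_zero_of_forall_eq_zero fun m => term_zero' hN hL m hn)
  map_add' f g := by
    ext n
    simp only [HahnSeries.coeff_ofSuppBddBelow, HahnSeries.coeff_add]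
    rw [← finsum_add_distrib (finite_terms ha f n) (finite_terms ha g n)]
    simp [mul_add]
  map_smul' c f := by
    ext n
    simp only [HahnSeries.coeff_ofSuppBddBelow, HahnSeries.coeff_smul, RingHom.id_apply,
      smul_eq_mul]
    rw [mul_finsum]
    simp [mul_smul_H]

theorem seriesOp_coeff (a : ℕ → H) (ha : ∃ N, DegLE a N) (f : H) (n : ℤ) :
    (seriesOp a ha f).coeff n = ∑ᶠ m : ℕ, (a m * (ddz ^ m) f).coeff n := rfl

/-- An auxiliary description of the operators `∑ₘ aₘ ∂ᵐ` with degrees bounded by `N`, as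
`∑ₑ z⁻ᵉ sₑ(z∂)` with polynomials `sₑ` of degree at most `e + N`. It only serves to prove that these
operators are closed under composition. -/
def HasSymbol (T : H →ₗ[ℂ] H) (N : ℤ) (s : ℤ → ℂ[X]) : Prop :=
  (∀ e, s e ≠ 0 → ((s e).natDegree : ℤ) ≤ e + N) ∧
  ∀ (f : H) (L : ℤ), (∀ k < L, f.coeff k = 0) → ∀ n : ℤ,
    (T f).coeff n = ∑ l ∈ Finset.Icc L (n + N), (s (n - l)).eval (-(l : ℂ)) * f.coeff l

/-- The symbol of `seriesOp a`. -/
def symb (a : ℕ → H) (N : ℤ) (e : ℤ) : ℂ[X] :=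
  ∑ m ∈ Finset.range (e + N + 1).toNat, C ((a m).coeff (e - m)) * descPochhammer ℂ m

theorem hasSymbol_seriesOp {a : ℕ → H} {N : ℤ} (h : DegLE a N) (ha : ∃ N, DegLE a N) :
    HasSymbol (seriesOp a ha) N (symb a N) := by
  have hz : ∀ (m : ℕ) (k : ℤ), k < -N → (a m).coeff k = 0 := fun m k hk => by
    simpa [zCoeff] using h m (-k) (by omega)
  refine ⟨fun e he => ?_, fun f L hf n => ?_⟩
  · have hpos : 0 < e + N + 1 := by
      by_contra hneg
      apply he
      rw [symb, Int.toNat_of_nonpos (by omega), Finset.range_zero, Finset.sum_empty]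
    have hdeg : (symb a N e).natDegree ≤ (e + N).toNat := by
      refine natDegree_sum_le_of_forall_le _ _ fun m hm => ?_
      rw [Finset.mem_range] at hm
      refine (natDegree_C_mul_le _ _).trans ?_
      rw [descPochhammer_natDegree]
      omega
    omega
  · set M := (n + N - L + 1).toNat with hM
    have h1 : (seriesOp a ha f).coeff n
        = ∑ m ∈ Finset.range M, (a m * (ddz ^ m) f).coeff n := by
      rw [seriesOp_coeff]
      refine finsum_eq_sum_of_support_subset _ fun m hm => ?_
      rw [Finset.coe_range, Set.mem_Iio]
      by_contra hlt
      exact hm (term_zero h hf (by omega))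
    have h2 : ∀ m : ℕ, (a m * (ddz ^ m) f).coeff n = ∑ l ∈ Finset.Icc L (n + N),
        (a m).coeff (n - l - m) * (descPochhammer ℂ m).eval (-(l : ℂ)) * f.coeff l := by
      intro m
      rw [mul_coeff_finset (A := -N) (B := L + m) (hz m)
        (fun k hk => by rw [ddz_pow_coeff, hf _ (by omega), mul_zero])]
      refine Finset.sum_bij_ne_zero (fun l _ _ => l - m) ?_ ?_ ?_ ?_
      · intro l hl _
        rw [Finset.mem_Icc] at hl
        simp only [Finset.mem_Icc]
        omega
      · intro l _ _ l' _ _ hll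
        simpa using hll
      · intro l hl hne
        rw [Finset.mem_Icc] at hl
        have h3 : -N ≤ n - l - m := not_lt.mp fun hlt => by
          rw [hz m _ hlt] at hne
          simp at hne
        refine ⟨l + m, by rw [Finset.mem_Icc]; omega, ?_, by omega⟩
        rw [ddz_pow_coeff]
        rw [← mul_assoc, show n - (l + m) = n - l - m by ring, show l + (m : ℤ) - m = l by ring,
          show (m : ℂ) - ((l + m : ℤ) : ℂ) = -(l : ℂ) by push_cast; ring]
        exact hne
      · intro l hl _
        rw [ddz_pow_coeff, ← mul_assoc, show n - (l - m) - m = n - l by ring,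
          show -((l - m : ℤ) : ℂ) = (m : ℂ) - (l : ℂ) by push_cast; ring]
    rw [h1, Finset.sum_congr rfl fun m _ => h2 m, Finset.sum_comm]
    refine Finset.sum_congr rfl fun l hl => ?_
    rw [Finset.mem_Icc] at hl
    rw [symb, eval_finsetSum, Finset.sum_mul]
    symm
    refine Finset.sum_subset_zero_on_sdiff (Finset.range_subset_range.mpr (by omega)) ?_ ?_
    · intro m hm
      rw [Finset.mem_sdiff, Finset.mem_range, Finset.mem_range] at hm
      rw [hz m _ (by omega), zero_mul, zero_mul]
    · intro m _
      simp

theorem HasSymbol.ext {T T' : H →ₗ[ℂ] H} {N : ℤ} {s : ℤ → ℂ[X]} (h : HasSymbol T N s)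
    (h' : HasSymbol T' N s) : T = T' := by
  ext f n
  obtain ⟨L, hL⟩ := exists_lower f
  rw [h.2 f L hL, h'.2 f L hL]

theorem exists_newton (d : ℕ) (p : ℂ[X]) (hp : p.natDegree < d) :
    ∃ c : ℕ → ℂ, p = ∑ m ∈ Finset.range d, C (c m) * descPochhammer ℂ m := by
  induction d generalizing p with
  | zero => omega
  | succ d ih =>
    rcases Nat.eq_zero_or_pos d with rfl | hd
    · refine ⟨fun _ => p.coeff 0, ?_⟩
      rw [Finset.sum_range_one, descPochhammer_zero, mul_one]
      exact eq_C_of_natDegree_le_zero (by omega)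
    · have hq : (p - C (p.coeff d) * descPochhammer ℂ d).natDegree < d := by
        suffices h0 : ∀ k, d ≤ k → (p - C (p.coeff d) * descPochhammer ℂ d).coeff k = 0 by
          by_contra hlt
          have h1 := h0 _ (not_lt.mp hlt)
          rw [coeff_natDegree, leadingCoeff_eq_zero] at h1
          rw [h1, natDegree_zero] at hlt
          omega
        intro k hk
        rw [coeff_sub, coeff_C_mul]
        rcases hk.eq_or_lt with rfl | hlt
        · have := (monic_descPochhammer ℂ d).coeff_natDegree
          rw [descPochhammer_natDegree] at this
          rw [this]; ring
        · rw [coeff_eq_zero_of_natDegree_lt (p := p) (by omega),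
            coeff_eq_zero_of_natDegree_lt (p := descPochhammer ℂ d)
              (by rw [descPochhammer_natDegree]; omega)]
          ring
      obtain ⟨c, hc⟩ := ih _ hq
      refine ⟨fun m => if m = d then p.coeff d else c m, ?_⟩
      rw [Finset.sum_range_succ]
      simp only [if_true]
      rw [Finset.sum_congr rfl (g := fun m =>
        C (c m) * descPochhammer ℂ m), ← hc]
      · ring
      · intro m hm
        rw [Finset.mem_range] at hm
        rw [if_neg (by omega)]

theorem HasSymbol.exists_series {T : H →ₗ[ℂ] H} {N : ℤ} {s : ℤ → ℂ[X]} (h : HasSymbol T N s) :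
    ∃ (a : ℕ → H) (ha : ∃ N, DegLE a N), T = seriesOp a ha := by
  have h1 : ∀ e : ℤ, ∃ c : ℕ → ℂ,
      s e = ∑ m ∈ Finset.range (e + N + 1).toNat, C (c m) * descPochhammer ℂ m := by
    intro e
    by_cases he : s e = 0
    · exact ⟨fun _ => 0, by simp [he]⟩
    · exact exists_newton _ _ (by have := h.1 e he; omega)
  choose c hc using h1
  let a : ℕ → H := fun m => HahnSeries.ofSuppBddBelow
    (fun k : ℤ => if k < -N then 0 else c (k + m) m)
    (bddBelow_of_zero (-N) fun k hk => if_pos hk)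
  have ha : DegLE a N := fun m k hk => if_pos (by omega)
  refine ⟨a, ⟨N, ha⟩, h.ext ?_⟩
  have : s = symb a N := by
    ext1 e
    rw [hc e, symb]
    refine Finset.sum_congr rfl fun m hm => ?_
    rw [Finset.mem_range] at hm
    have : (a m).coeff (e - m) = c e m := by
      change (if e - m < -N then 0 else c (e - m + m) m) = _
      rw [if_neg (by omega), sub_add_cancel]
    rw [this]
  rw [this]
  exact hasSymbol_seriesOp ha _

theorem HasSymbol.mul {T U : H →ₗ[ℂ] H} {N M : ℤ} {s t : ℤ → ℂ[X]} (hT : HasSymbol T N s)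
    (hU : HasSymbol U M t) :
    HasSymbol (T ∘ₗ U) (N + M) fun e =>
      ∑ j ∈ Finset.Icc (-M) (e + N), (s (e - j)).comp (X - C (j : ℂ)) * t j := by
  have hs0 : ∀ e, e < -N → s e = 0 := fun e he => by
    by_contra h
    have := hT.1 e h
    omega
  have ht0 : ∀ e, e < -M → t e = 0 := fun e he => by
    by_contra h
    have := hU.1 e h
    omega
  refine ⟨fun e he => ?_, fun f L hf n => ?_⟩
  · have hpos : 0 ≤ e + (N + M) := by
      by_contra hneg
      apply he
      simp only
      rw [Finset.Icc_eq_empty (by omega), Finset.sum_empty]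
    have : (∑ j ∈ Finset.Icc (-M) (e + N),
        (s (e - j)).comp (X - C (j : ℂ)) * t j).natDegree ≤ (e + (N + M)).toNat := by
      refine natDegree_sum_le_of_forall_le _ _ fun j _ => ?_
      by_cases h1 : s (e - j) = 0
      · simp [h1]
      by_cases h2 : t j = 0
      · simp [h2]
      have h3 := hT.1 _ h1
      have h4 := hU.1 _ h2
      refine natDegree_mul_le.trans ?_
      rw [natDegree_comp, natDegree_X_sub_C, mul_one]
      omega
    simp only
    omega
  · have hUf : ∀ k < L - M, (U f).coeff k = 0 := fun k hk => by
      rw [hU.2 f L hf, Finset.Icc_eq_empty (by omega), Finset.sum_empty]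
    rw [LinearMap.comp_apply, hT.2 _ _ hUf]
    have h1 : ∀ q ∈ Finset.Icc (L - M) (n + N), (U f).coeff q
        = ∑ l ∈ Finset.Icc L (n + (N + M)), (t (q - l)).eval (-(l : ℂ)) * f.coeff l := by
      intro q hq
      rw [Finset.mem_Icc] at hq
      rw [hU.2 f L hf]
      refine Finset.sum_subset (Finset.Icc_subset_Icc_right (by omega)) fun l hl hl' => ?_
      rw [Finset.mem_Icc] at hl hl'
      rw [ht0 _ (by omega), eval_zero, zero_mul]
    rw [Finset.sum_congr rfl fun q hq => by rw [h1 q hq, Finset.mul_sum], Finset.sum_comm]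
    refine Finset.sum_congr rfl fun l hl => ?_
    rw [Finset.mem_Icc] at hl
    rw [eval_finsetSum, Finset.sum_mul]
    symm
    refine Finset.sum_bij_ne_zero (fun j _ _ => l + j) ?_ ?_ ?_ ?_
    · intro j hj _
      rw [Finset.mem_Icc] at hj ⊢
      omega
    · intro j _ _ j' _ _ hjj
      simpa using hjj
    · intro q hq hne
      rw [Finset.mem_Icc] at hq
      have h2 : -M ≤ q - l := not_lt.mp fun hlt => by
        rw [ht0 _ hlt] at hne
        simp at hne
      refine ⟨q - l, by rw [Finset.mem_Icc]; omega, ?_, by omega⟩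
      convert hne using 1
      rw [eval_mul, eval_comp, show n - l - (q - l) = n - q by ring, mul_assoc]
      congr 2
      simp
      ring
    · intro j _ _
      rw [eval_mul, eval_comp, show n - l - j = n - (l + j) by ring,
        show l + j - l = j by ring, mul_assoc]
      congr 2
      simp
      ring

theorem seriesOp_mul_coeffs (f : H) :
    ∃ N, DegLE (fun m => if m = 0 then f else 0) N := by
  obtain ⟨L, hL⟩ := exists_lower f
  refine ⟨-L, fun m k hk => ?_⟩
  by_cases hm : m = 0
  · simp only [hm, if_true, zCoeff]
    exact hL _ (by omega)
  · simp [hm, zCoeff]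

/-- Multiplication by `f`. -/
def mulLin (f : H) : H →ₗ[ℂ] H where
  toFun g := f * g
  map_add' := mul_add f
  map_smul' c g := mul_smul_H c f g

theorem mulLin_eq_seriesOp (f : H) :
    mulLin f = seriesOp (fun m => if m = 0 then f else 0)
      (seriesOp_mul_coeffs f) := by
  ext g n
  rw [seriesOp_coeff, finsum_eq_single _ 0 (fun m hm => by simp [hm])]
  simp [mulLin]

theorem ddz_coeffs : ∃ N, DegLE (fun m => if m = 1 then (1 : H) else 0) N := by
  refine ⟨0, fun m k hk => ?_⟩
  by_cases hm : m = 1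
  · simp only [hm, if_true, zCoeff]
    rw [HahnSeries.coeff_one, if_neg (by omega)]
  · simp [hm, zCoeff]

theorem ddz_eq_seriesOp :
    ddz = seriesOp (fun m => if m = 1 then (1 : H) else 0) ddz_coeffs := by
  ext g n
  rw [seriesOp_coeff, finsum_eq_single _ 1 (fun m hm => by simp [hm])]
  simp

/-- The ring `𝒟 = ℂ((z⁻¹))[[∂]]` of differential operators `∑ₘ aₘ ∂ᵐ`, possibly of infinite order,
with coefficients `aₘ ∈ ℂ((z⁻¹))` whose degrees in `z` are uniformly bounded above. An operator is
identified with its action on `H`, which determines the coefficients (`seriesOp_injective`); the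
product is composition. -/
def DiffOp : Subring (Module.End ℂ H) where
  carrier := {T | ∃ (a : ℕ → H) (ha : ∃ N, DegLE a N), T = seriesOp a ha}
  mul_mem' := by
    rintro _ _ ⟨a, ha, rfl⟩ ⟨b, hb, rfl⟩
    obtain ⟨N, hN⟩ := id ha
    obtain ⟨M, hM⟩ := id hb
    exact ((hasSymbol_seriesOp hN ha).mul (hasSymbol_seriesOp hM hb)).exists_series
  add_mem' := by
    rintro _ _ ⟨a, ha, rfl⟩ ⟨b, hb, rfl⟩
    have hab : ∃ N, DegLE (a + b) N := by
      obtain ⟨N, hN⟩ := ha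
      obtain ⟨M, hM⟩ := hb
      refine ⟨max N M, fun m k hk => ?_⟩
      have h1 := hN m k (lt_of_le_of_lt (le_max_left _ _) hk)
      have h2 := hM m k (lt_of_le_of_lt (le_max_right _ _) hk)
      simp only [zCoeff] at h1 h2 ⊢
      simp [h1, h2]
    refine ⟨a + b, hab, ?_⟩
    ext f n
    rw [LinearMap.add_apply, HahnSeries.coeff_add, seriesOp_coeff, seriesOp_coeff, seriesOp_coeff,
      ← finsum_add_distrib (finite_terms ha f n) (finite_terms hb f n)]
    simp [add_mul]
  one_mem' := by
    refine ⟨_, seriesOp_mul_coeffs 1, ?_⟩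
    rw [← mulLin_eq_seriesOp]
    ext1 f
    exact (one_mul f).symm
  zero_mem' := by
    refine ⟨_, seriesOp_mul_coeffs 0, ?_⟩
    rw [← mulLin_eq_seriesOp]
    ext1 f
    exact (zero_mul f).symm
  neg_mem' := by
    rintro _ ⟨a, ha, rfl⟩
    have hna : ∃ N, DegLE (-a) N := by
      obtain ⟨N, hN⟩ := ha
      refine ⟨N, fun m k hk => ?_⟩
      have h1 := hN m k hk
      simp only [zCoeff] at h1 ⊢
      simp [h1]
    refine ⟨-a, hna, ?_⟩
    ext f n
    rw [LinearMap.neg_apply, HahnSeries.coeff_neg, seriesOp_coeff, seriesOp_coeff,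
      ← finsum_neg_distrib]
    refine finsum_congr fun m => ?_
    rw [Pi.neg_apply, ← HahnSeries.coeff_neg]
    exact congrArg (fun x : H => x.coeff n) (neg_mul (a m) ((ddz ^ m) f)).symm

/-- The coefficients of an operator are determined by its action on the powers of `z`. -/
theorem seriesOp_injective {a b : ℕ → H} (ha : ∃ N, DegLE a N) (hb : ∃ N, DegLE b N)
    (h : seriesOp a ha = seriesOp b hb) : a = b := by
  have hpow : ∀ (k m : ℕ), k < m → (ddz ^ m) (zpow k) = 0 := by
    intro k m hkm
    ext n
    rw [ddz_pow_coeff, zpow, HahnSeries.coeff_zero]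
    by_cases hn : n - m = -(k : ℤ)
    · have : (m : ℂ) - (n : ℂ) = (k : ℂ) := by
        have h3 : (m : ℤ) - n = k := by omega
        exact_mod_cast congrArg (Int.cast : ℤ → ℂ) h3
      rw [this, descPochhammer_eval_coe_nat_of_lt hkm, zero_mul]
    · rw [HahnSeries.coeff_single_of_ne hn, mul_zero]
  have htop : ∀ k : ℕ, (ddz ^ k) (zpow k) = (HahnSeries.single 0 (k.factorial : ℂ) : H) := by
    intro k
    ext n
    rw [ddz_pow_coeff, zpow]
    by_cases hn : n = 0
    · subst hn
      rw [show (0 : ℤ) - (k : ℤ) = -(k : ℤ) by ring, HahnSeries.coeff_single_same,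
        HahnSeries.coeff_single_same]
      simp [descPochhammer_eval_eq_descFactorial, Nat.descFactorial_self]
    · rw [HahnSeries.coeff_single_of_ne (by omega), HahnSeries.coeff_single_of_ne hn, mul_zero]
  have hval : ∀ (c : ℕ → H) (hc : ∃ N, DegLE c N) (k : ℕ), seriesOp c hc (zpow k)
      = ∑ m ∈ Finset.range k, c m * (ddz ^ m) (zpow k)
        + c k * (HahnSeries.single 0 (k.factorial : ℂ) : H) := by
    intro c hc k
    rw [← htop k, ← Finset.sum_range_succ (fun m => c m * (ddz ^ m) (zpow k))]
    ext n
    rw [seriesOp_coeff, HahnSeries.coeff_sum]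
    refine finsum_eq_sum_of_support_subset _ fun m hm => ?_
    rw [Finset.coe_range, Set.mem_Iio]
    by_contra hlt
    apply hm
    change (c m * (ddz ^ m) (zpow k)).coeff n = 0
    rw [hpow k m (by omega)]
    simp
  ext1 k
  induction k using Nat.strong_induction_on with
  | _ k ih =>
    have h1 : seriesOp a ha (zpow k) = seriesOp b hb (zpow k) := by rw [h]
    rw [hval, hval, Finset.sum_congr rfl fun m hm => by
      rw [ih m (Finset.mem_range.mp hm)]] at h1
    refine mul_right_cancel₀ ?_ (add_left_cancel h1)
    rw [Ne, HahnSeries.single_eq_zero_iff]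
    exact_mod_cast k.factorial_ne_zero

/-- `A = ∑ₘ aₘ ∂ᵐ`. -/
def HasCoeffs (A : DiffOp) (a : ℕ → H) : Prop :=
  ∃ ha : ∃ N, DegLE a N, (A : Module.End ℂ H) = seriesOp a ha

/-- Multiplication by `f ∈ ℂ((z⁻¹))` as an element of `𝒟`. -/
def mulOp (f : H) : DiffOp :=
  ⟨mulLin f, _, seriesOp_mul_coeffs f, mulLin_eq_seriesOp f⟩

/-- `∂ = d/dz` as an element of `𝒟`. -/
def dOp : DiffOp := ⟨ddz, _, ddz_coeffs, ddz_eq_seriesOp⟩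

/-- `z` as an element of `𝒟`. -/
def zOp : DiffOp := mulOp (zpow 1)

/-- `z⁻¹` as an element of `𝒟`. -/
def zInvOp : DiffOp := mulOp (zpow (-1))

/-- `H₊ = ℂ[z]`: the series without negative powers of `z`. -/
def Hplus : Submodule ℂ H where
  carrier := {f | ∀ k < 0, zCoeff f k = 0}
  add_mem' := fun hf hg k hk => by
    have h1 := hf k hk
    have h2 := hg k hk
    simp only [zCoeff] at h1 h2 ⊢
    simp [h1, h2]
  zero_mem' := fun k _ => by simp [zCoeff]
  smul_mem' := fun c f hf k hk => by
    have h1 := hf k hk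
    simp only [zCoeff] at h1 ⊢
    simp [h1]

/-- `H₋ = z⁻¹ℂ[[z⁻¹]]`: the series with only negative powers of `z`. -/
def Hminus : Submodule ℂ H where
  carrier := {f | ∀ k, 0 ≤ k → zCoeff f k = 0}
  add_mem' := fun hf hg k hk => by
    have h1 := hf k hk
    have h2 := hg k hk
    simp only [zCoeff] at h1 h2 ⊢
    simp [h1, h2]
  zero_mem' := fun k _ => by simp [zCoeff]
  smul_mem' := fun c f hf k hk => by
    have h1 := hf k hk
    simp only [zCoeff] at h1 ⊢
    simp [h1]

/-- The projection `π₊ : H → H₊` along `H₋`. -/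
def piPlus : H →ₗ[ℂ] Hplus where
  toFun f := ⟨HahnSeries.ofSuppBddBelow (fun n : ℤ => if n ≤ 0 then f.coeff n else 0) (by
      obtain ⟨L, hL⟩ := exists_lower f
      exact bddBelow_of_zero L fun n hn => by rw [hL n hn, ite_self]),
    fun k hk => if_neg (by omega)⟩
  map_add' f g := by
    ext n
    by_cases hn : n ≤ 0 <;> simp [hn]
  map_smul' c f := by
    ext n
    by_cases hn : n ≤ 0 <;> simp [hn]

/-- The big cell `Gr₊⁽⁰⁾` of the Sato Grassmannian: the closed subspaces `W` of `H` for which the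
projection `π₊ : W → H₊` has zero kernel and zero cokernel. -/
def BigCell : Set (Submodule ℂ H) :=
  {W | IsClosed (W : Set H) ∧ LinearMap.ker (piPlus.domRestrict W) = ⊥ ∧
    LinearMap.range (piPlus.domRestrict W) = ⊤}

/-- `𝒟₋ = z⁻¹ℂ[[z⁻¹]][[∂]]`. -/
def Dminus : Set DiffOp := {A | ∃ a : ℕ → H, HasCoeffs A a ∧ ∀ m, a m ∈ Hminus}

/-- `𝒢 = 1 + 𝒟₋`. -/
def SatoGroup : Set DiffOp := {G | G - 1 ∈ Dminus}

/-- `G` is a Sato group element of `W`: `G ∈ 1 + 𝒟₋` and `W = G · H₊`. -/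
def IsSatoElement (G : DiffOp) (W : Submodule ℂ H) : Prop :=
  G ∈ SatoGroup ∧ W = Hplus.map (G : Module.End ℂ H)

open Classical in
/-- Sato's group element `G_W` (the value `1` is a dummy, for `W` without such an element). -/
def satoElement (W : Submodule ℂ H) : DiffOp :=
  if h : ∃ G, IsSatoElement G W then h.choose else 1

/-- The canonical pair `ρ(W) = (G_W ∂ G_W⁻¹, G_W z G_W⁻¹)`. -/
def rho (W : Submodule ℂ H) : DiffOp × DiffOp :=
  (satoElement W * dOp * Ring.inverse (satoElement W),
    satoElement W * zOp * Ring.inverse (satoElement W))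

/-- `Gr_𝒟`: the pairs `(P, Q)` in `𝒟` with `[P, Q] = 1`, `P - ∂ ∈ z⁻¹𝒟₋` and `Q - z ∈ 𝒟₋`. -/
def GrD : Set (DiffOp × DiffOp) :=
  {PQ | PQ.1 * PQ.2 - PQ.2 * PQ.1 = 1 ∧ (∃ A ∈ Dminus, PQ.1 - dOp = zInvOp * A) ∧
    PQ.2 - zOp ∈ Dminus}

/-- The coefficient of the highest power of `z` occurring in `f` is `1`. -/
def IsMonic (f : H) : Prop := ∃ d : ℤ, zCoeff f d = 1 ∧ ∀ k, d < k → zCoeff f k = 0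

/-- The linear span (finite linear combinations) of `Ψ, Q · Ψ, Q² · Ψ, …`. -/
def spanOf (Q : DiffOp) (Ψ : H) : Submodule ℂ H :=
  Submodule.span ℂ (Set.range fun k : ℕ => (((Q ^ k : DiffOp) : Module.End ℂ H) Ψ))

end SatoKS

end

/-! The key is a calculus of symbols. Since `z ^ m ∂ᵐ` is the falling factorial of `z∂`, an operator
of `𝒟` can be written `∑ₑ z⁻ᵉ sₑ(z∂)` with polynomials `sₑ`; all coefficients of `∂ᵐ` have degree at
most `N` exactly when `deg sₑ ≤ e + N` for every `e`. In this form products are convolutions with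
shifts, so an equation in `𝒟` becomes a triangular system for the `sₑ`, solved level by level
(`exists_triangular`). This inverts `1 + 𝒟₋` (`exists_inverse`) and conjugates `∂ + R`, with `R` of
order `-2`, to `∂` (`exists_dressing`). The latter works because `z ^ (m - e) ∂ᵐ` is sent by the
commutator with `∂` to `m - e` times `z ^ (m - e - 1) ∂ᵐ`, and `m - e ≠ 0` on `𝒟₋`.

The Sato element exists because the `k`-th coefficient of `G` first acts on `z ^ k`, where it can be
chosen to put `G · z ^ k` into `W`; it is unique because an element of `1 + 𝒟₋` preserving `H₊` is
`1`.

Given `(P, Q)` in `Gr_𝒟`, dressing turns `P` into `∂` and `Q` into an operator `z + B` with `B ∈ 𝒟₋`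
and `[∂, B] = 0`. Only `B = 0` is possible (`eq_zero_of_commute_dOp`), so `(P, Q)` is conjugate to
`(∂, z)`. The remaining claims are transported from that pair: the kernel of `∂` is the constants,
and the powers of `z` applied to `1` span `H₊`. -/

noncomputable section

namespace SatoKS

open Polynomial

/-! ### Polynomials with integer degree bounds -/

/-- The degree of `p` is at most the integer `d`; for negative `d` this means `p = 0`. -/
def DegB (p : ℂ[X]) (d : ℤ) : Prop := p ≠ 0 → (p.natDegree : ℤ) ≤ d

theorem degB_iff {p : ℂ[X]} {d : ℤ} : DegB p d ↔ ∀ k : ℕ, d < k → p.coeff k = 0 := by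
  refine ⟨fun h k hk => ?_, fun h hp => ?_⟩
  · by_cases hp : p = 0
    · simp [hp]
    · exact coeff_eq_zero_of_natDegree_lt (by have := h hp; omega)
  · by_contra hlt
    exact hp (leadingCoeff_eq_zero.mp (h _ (by omega)))

theorem DegB.eq_zero {p : ℂ[X]} {d : ℤ} (h : DegB p d) (hd : d < 0) : p = 0 := by
  by_contra hp
  have := h hp
  omega

theorem DegB.mono {p : ℂ[X]} {d e : ℤ} (h : DegB p d) (hde : d ≤ e) : DegB p e :=
  fun hp => (h hp).trans hde

theorem degB_zero (d : ℤ) : DegB 0 d := fun h => (h rfl).elim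

theorem DegB.add {p q : ℂ[X]} {d : ℤ} (hp : DegB p d) (hq : DegB q d) : DegB (p + q) d := by
  rw [degB_iff] at *
  intro k hk
  rw [coeff_add, hp k hk, hq k hk, add_zero]

theorem DegB.neg {p : ℂ[X]} {d : ℤ} (hp : DegB p d) : DegB (-p) d := by
  rw [degB_iff] at *
  intro k hk
  rw [coeff_neg, hp k hk, neg_zero]

theorem degB_sum {ι : Type*} {s : Finset ι} {p : ι → ℂ[X]} {d : ℤ}
    (h : ∀ i ∈ s, DegB (p i) d) : DegB (∑ i ∈ s, p i) d := by
  rw [degB_iff]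
  intro k hk
  rw [finsetSum_coeff]
  exact Finset.sum_eq_zero fun i hi => degB_iff.mp (h i hi) k hk

theorem DegB.mul {p q : ℂ[X]} {d e : ℤ} (hp : DegB p d) (hq : DegB q e) :
    DegB (p * q) (d + e) := by
  intro hpq
  have h1 := hp (left_ne_zero_of_mul hpq)
  have h2 := hq (right_ne_zero_of_mul hpq)
  have h3 := natDegree_mul_le (p := p) (q := q)
  omega

theorem DegB.comp {p : ℂ[X]} {d : ℤ} (hp : DegB p d) (c : ℂ) :
    DegB (p.comp (X - C c)) d := by
  intro h
  rw [natDegree_comp, natDegree_X_sub_C, mul_one]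
  refine hp ?_
  rintro rfl
  simp at h

/-- A translation does not change the leading term, which therefore cancels. -/
theorem DegB.comp_sub_self {p : ℂ[X]} {d : ℤ} (hp : DegB p d) (c : ℂ) :
    DegB (p.comp (X + C c) - p) (d - 1) := by
  by_cases h0 : p = 0
  · simpa [h0] using degB_zero _
  intro hne
  rw [← taylor_apply] at *
  have hlt := degree_sub_lt_left (p := p) (q := taylor c p) (degree_taylor p c).symm h0
    (leadingCoeff_taylor c p).symm
  rw [← neg_sub, neg_ne_zero] at hne
  have h2 := natDegree_lt_natDegree hne hlt
  have h3 := hp h0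
  rw [← neg_sub, natDegree_neg]
  omega

/-- Polynomials of degree `< d` are spanned by the falling factorials of degree `< d`. -/
theorem DegB.exists_newton {p : ℂ[X]} {d : ℕ} (hp : DegB p ((d : ℤ) - 1)) :
    ∃ c : ℕ → ℂ, p = ∑ m ∈ Finset.range d, C (c m) * descPochhammer ℂ m := by
  by_cases h0 : p = 0
  · exact ⟨fun _ => 0, by simp [h0]⟩
  · exact SatoKS.exists_newton d p (by have := hp h0; omega)

/-! ### The commutator with `∂` on symbols -/

/-- The map induced on symbols at level `e` by the commutator with `∂`. -/
def commSymb (e : ℂ) (p : ℂ[X]) : ℂ[X] := (X - C e) * p - X * p.comp (X - 1)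

/-- The falling factorials diagonalize the commutator: this is `[∂, z ^ (m - e) ∂ᵐ] = (m - e) z ^ (m
- e - 1) ∂ᵐ`, read on symbols. -/
theorem commSymb_descPochhammer (e c : ℂ) (m : ℕ) :
    commSymb e (C c * descPochhammer ℂ m) = C (c * (m - e)) * descPochhammer ℂ m := by
  have h : X * (descPochhammer ℂ m).comp (X - 1) = descPochhammer ℂ m * (X - (m : ℂ[X])) := by
    rw [← descPochhammer_succ_left, descPochhammer_succ_right]
  rw [commSymb, mul_comp, C_comp, mul_left_comm X, h]
  simp only [C_mul, C_sub, C_eq_natCast]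
  ring

theorem commSymb_sum {ι : Type*} (e : ℂ) (s : Finset ι) (p : ι → ℂ[X]) :
    commSymb e (∑ i ∈ s, p i) = ∑ i ∈ s, commSymb e (p i) := by
  simp only [commSymb, Polynomial.sum_comp, Finset.mul_sum, Finset.sum_sub_distrib]

/-- Each of the two terms may have degree `d + 1`, but the map is diagonal in the basis of falling
factorials, so the degree does not grow. -/
theorem DegB.commSymb {p : ℂ[X]} {d : ℤ} (hp : DegB p d) (e : ℂ) : DegB (commSymb e p) d := by
  rcases lt_or_ge d 0 with hd | hd
  · rw [hp.eq_zero hd]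
    simpa [SatoKS.commSymb] using degB_zero _
  · lift d to ℕ using hd
    obtain ⟨c, rfl⟩ := DegB.exists_newton (d := d + 1) (hp.mono (by push_cast; omega))
    rw [commSymb_sum]
    refine degB_sum fun m hm => ?_
    rw [commSymb_descPochhammer, ← smul_eq_C_mul]
    rw [Finset.mem_range] at hm
    intro h
    refine (Nat.cast_le.mpr (natDegree_smul_le _ _)).trans ?_
    rw [descPochhammer_natDegree]
    omega

/-- The commutator with `∂` is onto on symbols of negative order. -/
theorem exists_commSymb_eq {e : ℕ} {q : ℂ[X]} (hq : DegB q ((e : ℤ) - 1)) :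
    ∃ p, DegB p ((e : ℤ) - 1) ∧ commSymb e p = q := by
  obtain ⟨c, rfl⟩ := hq.exists_newton
  refine ⟨∑ m ∈ Finset.range e, C (c m / (m - e)) * descPochhammer ℂ m, ?_, ?_⟩
  · refine degB_sum fun m hm => ?_
    rw [Finset.mem_range] at hm
    rw [← smul_eq_C_mul]
    intro h
    refine (Nat.cast_le.mpr (natDegree_smul_le _ _)).trans ?_
    rw [descPochhammer_natDegree]
    omega
  · rw [commSymb_sum]
    refine Finset.sum_congr rfl fun m hm => ?_
    rw [Finset.mem_range] at hm
    -- The eigenvalue `m - e` is nonzero because only `m < e` occurs.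
    rw [commSymb_descPochhammer, div_mul_cancel₀]
    rw [sub_ne_zero]
    exact_mod_cast hm.ne

/-! ### Recursive solution of triangular systems -/

/-- A sequence can be defined by prescribing each term in terms of the preceding ones. -/
theorem exists_strongRec {α : Type*} (S : (k : ℕ) → (Fin k → α) → α) :
    ∃ a : ℕ → α, ∀ k, a k = S k fun j => a j := by
  let a : ℕ → α := fun k => Nat.strongRec (motive := fun _ => α)
    (fun k ih => S k fun j => ih j j.2) k
  refine ⟨a, fun k => ?_⟩
  change Nat.strongRec (motive := fun _ => α) _ k = _
  rw [Nat.strongRec_eq]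

/-- Triangular systems of polynomial equations with strictly decreasing degrees are solvable. -/
theorem exists_triangular (L : ℕ → ℂ[X] → ℂ[X]) (c : ℕ → ℂ[X]) (K : ℕ → ℕ → ℂ[X])
    (hL : ∀ (e : ℕ) (q : ℂ[X]), DegB q ((e : ℤ) - 1) → ∃ p, DegB p ((e : ℤ) - 1) ∧ L e p = q)
    (hc : ∀ e : ℕ, DegB (c e) ((e : ℤ) - 1))
    (hK : ∀ e j : ℕ, j < e → DegB (K e j) ((e : ℤ) - j)) :
    ∃ t : ℕ → ℂ[X], ∀ e, DegB (t e) ((e : ℤ) - 1) ∧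
      L e (t e) = c e + ∑ j ∈ Finset.range e, K e j * t j := by
  classical
  choose! S hS using hL
  obtain ⟨t, ht⟩ := exists_strongRec fun e (ih : Fin e → ℂ[X]) =>
    S e (c e + ∑ j : Fin e, K e j * ih j)
  have ht' : ∀ e, t e = S e (c e + ∑ j ∈ Finset.range e, K e j * t j) := fun e => by
    rw [ht e, Fin.sum_univ_eq_sum_range (fun j => K e j * t j)]
  -- `S e` solves the equation only for right-hand sides of degree below `e`, so the bounds on the
  -- solution and on the right-hand side are proved together.
  have key : ∀ e : ℕ, DegB (t e) ((e : ℤ) - 1) ∧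
      DegB (c e + ∑ j ∈ Finset.range e, K e j * t j) ((e : ℤ) - 1) := by
    intro e
    induction e using Nat.strong_induction_on with
    | _ e ih =>
      have h : DegB (c e + ∑ j ∈ Finset.range e, K e j * t j) ((e : ℤ) - 1) := by
        refine (hc e).add (degB_sum fun j hj => ?_)
        rw [Finset.mem_range] at hj
        exact ((hK e j hj).mul (ih j hj).1).mono (by omega)
      refine ⟨?_, h⟩
      rw [ht' e]
      exact (hS e _ h).1
  refine ⟨t, fun e => ⟨(key e).1, ?_⟩⟩
  conv_lhs => rw [ht' e]
  exact (hS e _ (key e).2).2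

/-! ### Calculus of symbols -/

theorem HasSymbol.degB {T : H →ₗ[ℂ] H} {N : ℤ} {s : ℤ → ℂ[X]} (h : HasSymbol T N s) (e : ℤ) :
    DegB (s e) (e + N) := h.1 e

theorem HasSymbol.eq_zero_of_lt {T : H →ₗ[ℂ] H} {N : ℤ} {s : ℤ → ℂ[X]} (h : HasSymbol T N s)
    {e : ℤ} (he : e < -N) : s e = 0 := (h.degB e).eq_zero (by omega)

/-- The order only truncates the sum, and the terms beyond either cutoff vanish because their
symbols have negative degree bound. Hence a sharper bound found after a cancellation may replace the
order. -/
theorem HasSymbol.change_order {T : H →ₗ[ℂ] H} {N N' : ℤ} {s : ℤ → ℂ[X]} (h : HasSymbol T N s)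
    (h' : ∀ e, DegB (s e) (e + N')) : HasSymbol T N' s := by
  refine ⟨h', fun f L hf n => ?_⟩
  have aux : ∀ M : ℤ, (∀ e, DegB (s e) (e + M)) → ∀ M' ≥ M,
      ∑ l ∈ Finset.Icc L (n + M), (s (n - l)).eval (-(l : ℂ)) * f.coeff l
        = ∑ l ∈ Finset.Icc L (n + M'), (s (n - l)).eval (-(l : ℂ)) * f.coeff l := by
    intro M hM M' hMM
    refine Finset.sum_subset (Finset.Icc_subset_Icc_right (by omega)) fun l hl hl' => ?_
    rw [Finset.mem_Icc] at hl hl'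
    rw [(hM (n - l)).eq_zero (by omega), eval_zero, zero_mul]
  rw [h.2 f L hf, aux N h.1 (max N N') (le_max_left _ _), aux N' h' (max N N') (le_max_right _ _)]

theorem HasSymbol.mono {T : H →ₗ[ℂ] H} {N N' : ℤ} {s : ℤ → ℂ[X]} (h : HasSymbol T N s)
    (hN : N ≤ N') : HasSymbol T N' s :=
  h.change_order fun e => (h.degB e).mono (by omega)

theorem HasSymbol.add {T U : H →ₗ[ℂ] H} {N : ℤ} {s t : ℤ → ℂ[X]} (hT : HasSymbol T N s)
    (hU : HasSymbol U N t) : HasSymbol (T + U) N (s + t) := by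
  refine ⟨fun e => (hT.degB e).add (hU.degB e), fun f L hf n => ?_⟩
  rw [LinearMap.add_apply, HahnSeries.coeff_add, hT.2 f L hf, hU.2 f L hf,
    ← Finset.sum_add_distrib]
  simp [add_mul]

theorem HasSymbol.neg {T : H →ₗ[ℂ] H} {N : ℤ} {s : ℤ → ℂ[X]} (hT : HasSymbol T N s) :
    HasSymbol (-T) N (-s) := by
  refine ⟨fun e => (hT.degB e).neg, fun f L hf n => ?_⟩
  rw [LinearMap.neg_apply, HahnSeries.coeff_neg, hT.2 f L hf, ← Finset.sum_neg_distrib]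
  simp

theorem HasSymbol.sub {T U : H →ₗ[ℂ] H} {N : ℤ} {s t : ℤ → ℂ[X]} (hT : HasSymbol T N s)
    (hU : HasSymbol U N t) : HasSymbol (T - U) N (s - t) := by
  rw [sub_eq_add_neg T, sub_eq_add_neg s]
  exact hT.add hU.neg

theorem HasSymbol.eq_zero {T : H →ₗ[ℂ] H} {N : ℤ} (h : HasSymbol T N 0) : T = 0 := by
  ext f n
  obtain ⟨L, hL⟩ := exists_lower f
  rw [h.2 f L hL]
  simp

/-- The operators `∂`, `z ^ k` and `1` have symbols concentrated at one level. -/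
theorem hasSymbol_single {T : H →ₗ[ℂ] H} {N j : ℤ} {p : ℂ[X]} (hp : DegB p (j + N))
    (hT : ∀ f n, (T f).coeff n = p.eval ((j : ℂ) - n) * f.coeff (n - j)) :
    HasSymbol T N (Pi.single j p) := by
  refine ⟨fun e he => ?_, fun f L hf n => ?_⟩
  · rcases eq_or_ne e j with rfl | hej
    · rw [Pi.single_eq_same] at he ⊢
      exact hp he
    · rw [Pi.single_eq_of_ne hej] at he
      exact (he rfl).elim
  · rw [hT, Finset.sum_eq_single (n - j)]
    · rw [sub_sub_cancel, Pi.single_eq_same]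
      push_cast
      rw [neg_sub]
    · intro l _ hl
      rw [Pi.single_eq_of_ne (by omega), eval_zero, zero_mul]
    · intro hl
      rw [Finset.mem_Icc] at hl
      rcases lt_or_ge (n - j) L with h | h
      · rw [hf _ h, mul_zero]
      · rw [sub_sub_cancel, Pi.single_eq_same, hp.eq_zero (by omega), eval_zero, zero_mul]

theorem hasSymbol_one : HasSymbol 1 0 (Pi.single 0 1) :=
  hasSymbol_single (fun _ => by simp) fun f n => by simp

theorem hasSymbol_ddz : HasSymbol ddz 0 (Pi.single 1 X) :=
  hasSymbol_single (fun _ => by simp) fun f n => by simp [ddz_coeff]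

theorem hasSymbol_mulLin_zpow (k : ℤ) : HasSymbol (mulLin (zpow k)) k (Pi.single (-k) 1) :=
  hasSymbol_single (fun _ => by simp) fun f n => by
    change (zpow k * f).coeff n = _
    rw [zpow, HahnSeries.coeff_single_mul, eval_one]

theorem HasSymbol.mul_single {T U : H →ₗ[ℂ] H} {N M j : ℤ} {s : ℤ → ℂ[X]} {p : ℂ[X]}
    (hT : HasSymbol T N s) (hU : HasSymbol U M (Pi.single j p)) :
    HasSymbol (T ∘ₗ U) (N + M) fun e => (s (e - j)).comp (X - C (j : ℂ)) * p := by
  convert hT.mul hU using 1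
  ext1 e
  rw [Finset.sum_eq_single j, Pi.single_eq_same]
  · intro i _ hi
    rw [Pi.single_eq_of_ne hi, mul_zero]
  · intro hj
    rw [Finset.mem_Icc] at hj
    rcases lt_or_ge j (-M) with h | h
    · rw [hU.eq_zero_of_lt h, mul_zero]
    · rw [hT.eq_zero_of_lt (by omega), zero_comp, zero_mul]

theorem HasSymbol.single_mul {T U : H →ₗ[ℂ] H} {N M j : ℤ} {s : ℤ → ℂ[X]} {p : ℂ[X]}
    (hT : HasSymbol T N (Pi.single j p)) (hU : HasSymbol U M s) :
    HasSymbol (T ∘ₗ U) (N + M) fun e => p.comp (X - C ((e - j : ℤ) : ℂ)) * s (e - j) := by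
  convert hT.mul hU using 1
  ext1 e
  rw [Finset.sum_eq_single (e - j), sub_sub_cancel, Pi.single_eq_same]
  · intro i _ hi
    rw [Pi.single_eq_of_ne (by omega), zero_comp, zero_mul]
  · intro hj
    rw [Finset.mem_Icc] at hj
    rcases lt_or_ge (e - j) (-M) with h | h
    · rw [hU.eq_zero_of_lt h, mul_zero]
    · rw [sub_sub_cancel, hT.eq_zero_of_lt (by omega), zero_comp, zero_mul]

/-- `∂` moves level `e - 1` to level `e` while `commSymb` keeps the degree bound; this is the gain
of one order. -/
theorem HasSymbol.comm_ddz {T : H →ₗ[ℂ] H} {N : ℤ} {s : ℤ → ℂ[X]} (hT : HasSymbol T N s) :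
    HasSymbol (ddz ∘ₗ T - T ∘ₗ ddz) (N - 1)
      fun e => commSymb ((e - 1 : ℤ) : ℂ) (s (e - 1)) := by
  have h1 := hasSymbol_ddz.single_mul hT
  have h2 := hT.mul_single hasSymbol_ddz
  rw [zero_add] at h1
  rw [add_zero] at h2
  have h3 : HasSymbol (ddz ∘ₗ T - T ∘ₗ ddz) N
      fun e => commSymb ((e - 1 : ℤ) : ℂ) (s (e - 1)) := by
    convert h1.sub h2 using 1
    ext1 e
    simp [commSymb, mul_comm X]
  exact h3.change_order fun e => ((hT.degB (e - 1)).commSymb _).mono (by omega)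

/-- A product with `z` has order `N + 1`, but the commutator has symbol `s (e + 1)` shifted by one
minus itself, which loses a degree. -/
theorem HasSymbol.comm_z {T : H →ₗ[ℂ] H} {N : ℤ} {s : ℤ → ℂ[X]} (hT : HasSymbol T N s) :
    ∃ t, HasSymbol (T ∘ₗ mulLin (zpow 1) - mulLin (zpow 1) ∘ₗ T) N t := by
  have h1 := hT.mul_single (hasSymbol_mulLin_zpow 1)
  have h2 := (hasSymbol_mulLin_zpow 1).single_mul hT
  rw [add_comm 1 N] at h2
  refine ⟨_, (h1.sub h2).change_order fun e => ?_⟩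
  convert ((hT.degB (e - -1)).comp_sub_self 1).mono (show _ ≤ e + N by omega) using 1
  simp

/-- Every family of polynomials with the right degrees is the symbol of an operator. -/
theorem exists_seriesOp_hasSymbol {N : ℤ} {s : ℤ → ℂ[X]} (hs : ∀ e, DegB (s e) (e + N)) :
    ∃ (a : ℕ → H) (ha : DegLE a N), HasSymbol (seriesOp a ⟨N, ha⟩) N s := by
  have h1 : ∀ e : ℤ, ∃ c : ℕ → ℂ,
      s e = ∑ m ∈ Finset.range (e + N + 1).toNat, C (c m) * descPochhammer ℂ m := by
    intro e
    by_cases he : s e = 0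
    · exact ⟨fun _ => 0, by simp [he]⟩
    · exact exists_newton _ _ (by have := hs e he; omega)
  choose c hc using h1
  let a : ℕ → H := fun m => HahnSeries.ofSuppBddBelow
    (fun k : ℤ => if k < -N then 0 else c (k + m) m)
    (bddBelow_of_zero (-N) fun k hk => if_pos hk)
  have ha : DegLE a N := fun m k hk => if_pos (by omega)
  refine ⟨a, ha, ?_⟩
  have : s = symb a N := by
    ext1 e
    rw [hc e, symb]
    refine Finset.sum_congr rfl fun m hm => ?_
    rw [Finset.mem_range] at hm
    have : (a m).coeff (e - m) = c e m := by
      change (if e - m < -N then 0 else c (e - m + m) m) = _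
      rw [if_neg (by omega), sub_add_cancel]
    rw [this]
  rw [this]
  exact hasSymbol_seriesOp ha _

/-! ### Orders of operators, `𝒟₋` and the group `1 + 𝒟₋` -/

/-- The operator `A` raises degrees by at most `N`: it has a symbol of order `N`. -/
def OrdLE (A : DiffOp) (N : ℤ) : Prop := ∃ s, HasSymbol (A : Module.End ℂ H) N s

theorem OrdLE.mono {A : DiffOp} {N M : ℤ} (h : OrdLE A N) (hNM : N ≤ M) : OrdLE A M :=
  h.imp fun _ hs => hs.mono hNM

theorem OrdLE.add {A B : DiffOp} {N : ℤ} (hA : OrdLE A N) (hB : OrdLE B N) : OrdLE (A + B) N := by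
  obtain ⟨s, hs⟩ := hA
  obtain ⟨t, ht⟩ := hB
  exact ⟨_, hs.add ht⟩

theorem OrdLE.neg {A : DiffOp} {N : ℤ} (hA : OrdLE A N) : OrdLE (-A) N := by
  obtain ⟨s, hs⟩ := hA
  exact ⟨_, hs.neg⟩

theorem OrdLE.mul {A B : DiffOp} {N M : ℤ} (hA : OrdLE A N) (hB : OrdLE B M) :
    OrdLE (A * B) (N + M) := by
  obtain ⟨s, hs⟩ := hA
  obtain ⟨t, ht⟩ := hB
  exact ⟨_, hs.mul ht⟩

theorem ordLE_one : OrdLE 1 0 := ⟨_, hasSymbol_one⟩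

theorem ordLE_mulOp_zpow (k : ℤ) : OrdLE (mulOp (zpow k)) k := ⟨_, hasSymbol_mulLin_zpow k⟩

theorem OrdLE.comm_dOp {A : DiffOp} {N : ℤ} (hA : OrdLE A N) :
    OrdLE (dOp * A - A * dOp) (N - 1) := by
  obtain ⟨s, hs⟩ := hA
  exact ⟨_, hs.comm_ddz⟩

theorem OrdLE.comm_zOp {A : DiffOp} {N : ℤ} (hA : OrdLE A N) :
    OrdLE (A * zOp - zOp * A) N := by
  obtain ⟨s, hs⟩ := hA
  exact hs.comm_z

theorem degLE_neg_one_iff {a : ℕ → H} : DegLE a (-1) ↔ ∀ m, a m ∈ Hminus :=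
  forall_congr' fun _ => forall_congr' fun _ => by rw [← Int.add_one_le_iff, neg_add_cancel]

/-- An operator with a given symbol is a differential operator with coefficients of bounded
degree. -/
theorem exists_diffOp_hasSymbol {N : ℤ} {s : ℤ → ℂ[X]} (hs : ∀ e, DegB (s e) (e + N)) :
    ∃ A : DiffOp, HasSymbol (A : Module.End ℂ H) N s := by
  obtain ⟨a, ha, h⟩ := exists_seriesOp_hasSymbol hs
  exact ⟨⟨seriesOp a ⟨N, ha⟩, a, ⟨N, ha⟩, rfl⟩, h⟩

/-- Membership in `𝒟₋` becomes an order bound, which is stable under sums and products by the symbol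
calculus. -/
theorem mem_Dminus_iff {A : DiffOp} : A ∈ Dminus ↔ OrdLE A (-1) := by
  constructor
  · rintro ⟨a, ⟨ha, h⟩, hm⟩
    exact ⟨_, h ▸ hasSymbol_seriesOp (degLE_neg_one_iff.mpr hm) ha⟩
  · rintro ⟨s, hs⟩
    obtain ⟨a, ha, h⟩ := exists_seriesOp_hasSymbol hs.1
    exact ⟨a, ⟨⟨_, ha⟩, hs.ext h⟩, degLE_neg_one_iff.mp ha⟩

theorem zInvOp_mul_zOp : zInvOp * zOp = 1 := by
  ext f n
  change (zpow (-1) * (zpow 1 * f)).coeff n = f.coeff n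
  simp [zpow, ← mul_assoc]

theorem exists_zInvOp_mul_iff {A : DiffOp} :
    (∃ B ∈ Dminus, A = zInvOp * B) ↔ OrdLE A (-2) := by
  constructor
  · rintro ⟨B, hB, rfl⟩
    exact (ordLE_mulOp_zpow (-1)).mul (mem_Dminus_iff.mp hB)
  · intro h
    refine ⟨zOp * A, mem_Dminus_iff.mpr ?_, by rw [← mul_assoc, zInvOp_mul_zOp, one_mul]⟩
    exact (ordLE_mulOp_zpow 1).mul h

theorem mem_SatoGroup_iff {G : DiffOp} : G ∈ SatoGroup ↔ OrdLE (G - 1) (-1) := mem_Dminus_iff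

theorem ordLE_zero_of_mem {G : DiffOp} (h : G ∈ SatoGroup) : OrdLE G 0 := by
  rw [mem_SatoGroup_iff] at h
  simpa using (h.mono (by norm_num)).add ordLE_one

theorem mul_mem_SatoGroup {G K : DiffOp} (hG : G ∈ SatoGroup) (hK : K ∈ SatoGroup) :
    G * K ∈ SatoGroup := by
  have h0 := ordLE_zero_of_mem hK
  rw [mem_SatoGroup_iff] at *
  have : G * K - 1 = (G - 1) * K + (K - 1) := by noncomm_ring
  rw [this]
  exact (hG.mul h0).add hK

/-! ### Inversion and dressing -/

/-- Extend a sequence by zero to the negative integers. -/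
def extZ (t : ℕ → ℂ[X]) (e : ℤ) : ℂ[X] := if 0 ≤ e then t e.toNat else 0

@[simp] theorem extZ_natCast (t : ℕ → ℂ[X]) (e : ℕ) : extZ t e = t e := by simp [extZ]

theorem extZ_neg (t : ℕ → ℂ[X]) {e : ℤ} (he : e < 0) : extZ t e = 0 := if_neg (by omega)

theorem degB_extZ {t : ℕ → ℂ[X]} (h : ∀ e : ℕ, DegB (t e) ((e : ℤ) - 1)) (e : ℤ) :
    DegB (extZ t e) (e + -1) := by
  rcases lt_or_ge e 0 with he | he
  · rw [extZ_neg t he]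
    exact degB_zero _
  · lift e to ℕ using he
    rw [extZ_natCast]
    exact h e

theorem extZ_apply_zero {t : ℕ → ℂ[X]} (h : ∀ e : ℕ, DegB (t e) ((e : ℤ) - 1)) : t 0 = 0 :=
  (h 0).eq_zero (by norm_num)

theorem sum_range_eq_sum_Icc {M : Type*} [AddCommMonoid M] (f : ℤ → M) (h0 : f 0 = 0) (e : ℕ) :
    ∑ j ∈ Finset.range e, f j = ∑ j ∈ Finset.Icc 1 ((e : ℤ) - 1), f j := by
  refine Finset.sum_bij_ne_zero (fun j _ _ => (j : ℤ)) ?_ ?_ ?_ ?_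
  · intro j hj hne
    rw [Finset.mem_range] at hj
    rw [Finset.mem_Icc]
    have : j ≠ 0 := by
      rintro rfl
      exact hne h0
    omega
  · intro i _ _ j _ _ hij
    exact_mod_cast hij
  · intro j hj hne
    rw [Finset.mem_Icc] at hj
    lift j to ℕ using by omega
    exact ⟨j, by rw [Finset.mem_range]; omega, hne, rfl⟩
  · intros
    rfl

/-- Every element of `1 + 𝒟₋` has a right inverse in `1 + 𝒟₋`. -/
theorem exists_right_inverse {G : DiffOp} (hG : G ∈ SatoGroup) :
    ∃ K ∈ SatoGroup, G * K = 1 := by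
  obtain ⟨s, hs⟩ := mem_SatoGroup_iff.mp hG
  -- With `A = G - 1` and `K = 1 + B`, the equation `G * K = 1` reads `B + A + A * B = 0`; this is
  -- its component at level `e`, solved for the symbol of `B`.
  obtain ⟨t, ht⟩ := exists_triangular (fun _ p => p) (fun e => -s e)
    (fun e j => -(s (e - j)).comp (X - C (j : ℂ))) (fun e q hq => ⟨q, hq, rfl⟩)
    (fun e => (hs.degB e).neg)
    (fun e j _ => ((hs.degB _).comp _).neg.mono (by omega))
  have htd := fun e => (ht e).1
  obtain ⟨B, hB⟩ := exists_diffOp_hasSymbol (degB_extZ htd)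
  refine ⟨1 + B, mem_SatoGroup_iff.mpr ⟨_, by simpa using hB⟩, ?_⟩
  have h0 : B + (G - 1) + (G - 1) * B = 0 := by
    ext1
    refine HasSymbol.eq_zero (N := -1) ?_
    convert (hB.add hs).add ((hs.mul hB).mono (show _ ≤ (-1 : ℤ) by norm_num)) using 1
    · rfl
    · ext1 e
      simp only [Pi.zero_apply, Pi.add_apply, neg_neg]
      rcases lt_or_ge e 0 with he | he
      · rw [extZ_neg t he, hs.eq_zero_of_lt (by omega), Finset.Icc_eq_empty (by omega)]
        simp
      · lift e to ℕ using he
        have h1 := (ht e).2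
        have h2 := sum_range_eq_sum_Icc
          (fun j => (s (e - j)).comp (X - C (j : ℂ)) * extZ t j)
          (by rw [← Nat.cast_zero, extZ_natCast, extZ_apply_zero htd, mul_zero]) e
        simp only [extZ_natCast, Int.cast_natCast] at h2
        simp only [neg_mul, Finset.sum_neg_distrib] at h1
        rw [h2] at h1
        rw [extZ_natCast, h1, ← sub_eq_add_neg (e : ℤ) 1]
        ring
  calc G * (1 + B) = 1 + (B + (G - 1) + (G - 1) * B) := by noncomm_ring
    _ = 1 := by rw [h0, add_zero]

/-- The right inverse `K` has a right inverse as well, which must be `G` because `G` is a left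
inverse of `K`. -/
theorem exists_inverse {G : DiffOp} (hG : G ∈ SatoGroup) :
    ∃ K ∈ SatoGroup, G * K = 1 ∧ K * G = 1 := by
  obtain ⟨K, hK, h⟩ := exists_right_inverse hG
  obtain ⟨G', _, h'⟩ := exists_right_inverse hK
  have : G = G' := left_inv_eq_right_inv h h'
  exact ⟨K, hK, h, this ▸ h'⟩

/-- A perturbation of `∂` of order `-2` is conjugate to `∂` by an element of `1 + 𝒟₋`. -/
theorem exists_dressing {R : DiffOp} (hR : OrdLE R (-2)) :
    ∃ G ∈ SatoGroup, (dOp + R) * G = G * dOp := by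
  obtain ⟨r, hr⟩ := hR
  -- For `G = 1 + B` the claim is `[∂, B] + R + R * B = 0`, taken here at level `e + 1`. As `R` has
  -- order `-2`, only levels of `B` below `e` enter through `R * B`.
  obtain ⟨t, ht⟩ := exists_triangular (fun e p => commSymb (e : ℂ) p)
    (fun e => -r (e + 1))
    (fun e j => -(r (e + 1 - j)).comp (X - C (j : ℂ))) (fun e q hq => exists_commSymb_eq hq)
    (fun e => (hr.degB _).neg.mono (by omega))
    (fun e j _ => ((hr.degB _).comp _).neg.mono (by omega))
  have htd := fun e => (ht e).1
  obtain ⟨B, hB⟩ := exists_diffOp_hasSymbol (degB_extZ htd)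
  refine ⟨1 + B, mem_SatoGroup_iff.mpr ⟨_, by simpa using hB⟩, ?_⟩
  have h0 : (dOp * B - B * dOp) + R + R * B = 0 := by
    ext1
    refine HasSymbol.eq_zero (N := -2) ?_
    convert ((hB.comm_ddz.mono (show _ ≤ (-2 : ℤ) by norm_num)).add hr).add
      ((hr.mul hB).mono (show _ ≤ (-2 : ℤ) by norm_num)) using 1
    · rfl
    · ext1 e
      simp only [Pi.zero_apply, Pi.add_apply, neg_neg]
      -- The commutator with `∂` raises levels by one, so level `e + 1` is the equation for `t e`.
      obtain ⟨e, rfl⟩ : ∃ e', e = e' + 1 := ⟨e - 1, by ring⟩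
      rw [add_sub_cancel_right]
      rcases lt_or_ge e 0 with he | he
      · rw [extZ_neg t he, hr.eq_zero_of_lt (by omega), Finset.Icc_eq_empty (by omega)]
        simp [commSymb]
      · lift e to ℕ using he
        have h1 := (ht e).2
        have h2 := sum_range_eq_sum_Icc
          (fun j => (r (e + 1 - j)).comp (X - C (j : ℂ)) * extZ t j)
          (by rw [← Nat.cast_zero, extZ_natCast, extZ_apply_zero htd, mul_zero]) e
        simp only [extZ_natCast, Int.cast_natCast] at h2
        simp only [neg_mul, Finset.sum_neg_distrib] at h1
        rw [h2] at h1
        rw [extZ_natCast, Int.cast_natCast, h1, show (e : ℤ) + 1 + -2 = e - 1 by ring]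
        ring
  rw [← sub_eq_zero, ← h0]
  noncomm_ring

/-! ### Coefficients, degrees and the splitting of `H` -/

@[simp] theorem zCoeff_add (f g : H) (k : ℤ) : zCoeff (f + g) k = zCoeff f k + zCoeff g k := rfl

@[simp] theorem zCoeff_sub (f g : H) (k : ℤ) : zCoeff (f - g) k = zCoeff f k - zCoeff g k := by
  simp [zCoeff]

@[simp] theorem zCoeff_smul (c : ℂ) (f : H) (k : ℤ) : zCoeff (c • f) k = c * zCoeff f k := rfl

@[simp] theorem zCoeff_zero (k : ℤ) : zCoeff 0 k = 0 := rfl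

theorem H_ext {f g : H} (h : ∀ k, zCoeff f k = zCoeff g k) : f = g := by
  ext n
  have := h (-n)
  rwa [zCoeff, zCoeff, neg_neg] at this

theorem zCoeff_zpow (k l : ℤ) : zCoeff (zpow k) l = if l = k then 1 else 0 := by
  rw [zCoeff, zpow]
  split_ifs with h
  · rw [h, HahnSeries.coeff_single_same]
  · exact HahnSeries.coeff_single_of_ne (by omega)

theorem H_zero_smul (f : H) : (0 : ℂ) • f = 0 :=
  H_ext fun k => by rw [zCoeff_smul, zero_mul, zCoeff_zero]

theorem eq_zero_of_smul {c : ℂ} (hc : c ≠ 0) {f : H} (h : c • f = 0) : f = 0 :=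
  H_ext fun k => by
    have h1 := congrArg (zCoeff · k) h
    simp only [zCoeff_smul, zCoeff_zero] at h1
    exact (mul_eq_zero.mp h1).resolve_left hc

/-- All powers of `z` occurring in `f` have exponent less than `d`. -/
def DegLt (f : H) (d : ℤ) : Prop := ∀ k, d ≤ k → zCoeff f k = 0

theorem exists_degLt (f : H) : ∃ d : ℕ, DegLt f d := by
  obtain ⟨L, hL⟩ := exists_lower f
  exact ⟨(1 - L).toNat, fun k hk => hL _ (by omega)⟩

theorem eq_zero_of_mem {f : H} (hp : f ∈ Hplus) (hm : f ∈ Hminus) : f = 0 := by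
  refine H_ext fun k => ?_
  rcases lt_or_ge k 0 with h | h
  · exact hp k h
  · exact hm k h

theorem zpow_mem_Hplus (k : ℕ) : zpow k ∈ Hplus := fun l hl => by
  rw [zCoeff_zpow, if_neg (by omega)]

theorem span_zpow : Submodule.span ℂ (Set.range fun k : ℕ => zpow k) = Hplus := by
  refine le_antisymm (Submodule.span_le.mpr ?_) fun f hf => ?_
  · rintro _ ⟨k, rfl⟩
    exact zpow_mem_Hplus k
  · obtain ⟨d, hd⟩ := exists_degLt f
    have : f = ∑ k ∈ Finset.range d, zCoeff f k • zpow k := by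
      refine H_ext fun l => ?_
      have h1 : zCoeff (∑ k ∈ Finset.range d, zCoeff f k • zpow k) l
          = ∑ k ∈ Finset.range d, zCoeff f k * zCoeff (zpow k) l :=
        HahnSeries.coeff_sum ..
      rw [h1]
      simp only [zCoeff_zpow]
      rcases lt_or_ge l 0 with hl | hl
      · rw [hf l hl, Finset.sum_eq_zero]
        intro k _
        rw [if_neg (by omega), mul_zero]
      · lift l to ℕ using hl
        simp only [Nat.cast_inj, mul_ite, mul_one, mul_zero, Finset.sum_ite_eq, Finset.mem_range]
        split_ifs with h
        · rfl
        · exact hd l (by omega)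
    rw [this]
    exact Submodule.sum_mem _ fun k _ =>
      Submodule.smul_mem _ _ (Submodule.subset_span ⟨k, rfl⟩)

theorem OrdLE.degLt {A : DiffOp} {N d : ℤ} (hA : OrdLE A N) {f : H} (hf : DegLt f d) :
    DegLt ((A : Module.End ℂ H) f) (d + N) := by
  obtain ⟨s, hs⟩ := hA
  intro k hk
  rw [zCoeff, hs.2 f (1 - d), Finset.Icc_eq_empty (by omega), Finset.sum_empty]
  intro l hl
  have := hf (-l) (by omega)
  rwa [zCoeff, neg_neg] at this

theorem sub_piPlus_mem (f : H) : f - piPlus f ∈ Hminus := by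
  intro k hk
  rw [zCoeff_sub, sub_eq_zero]
  exact (if_pos (by omega)).symm

theorem piPlus_eq_iff {f : H} {p : Hplus} : piPlus f = p ↔ f - p ∈ Hminus := by
  constructor
  · rintro rfl
    exact sub_piPlus_mem f
  · intro h
    rw [← sub_eq_zero]
    refine Subtype.ext (eq_zero_of_mem (piPlus f - p).2 ?_)
    have := Hminus.sub_mem h (sub_piPlus_mem f)
    rwa [sub_sub_sub_cancel_left] at this

/-! ### Topology and the big cell -/

/-- `H₋` is a closed ball for the valuation, and such balls of nonzero radius are open. -/
theorem isOpen_Hminus : IsOpen (Hminus : Set H) := by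
  have : (Hminus : Set H) = {f : H | Valued.v.restrict f ≤ Valued.v.restrict (zpow (-1))} := by
    ext f
    rw [Set.mem_ofPred_eq, Valuation.restrict_le_iff, zpow, neg_neg,
      LaurentSeries.valuation_single_zpow, LaurentSeries.valuation_le_iff_coeff_lt_eq_zero]
    refine ⟨fun h n hn => ?_, fun h k hk => h _ (by omega)⟩
    have := h (-n) (by omega)
    rwa [zCoeff, neg_neg] at this
  rw [this]
  refine Valued.isOpen_closedBall H ((_root_.map_ne_zero _).mpr ?_)
  rw [zpow, Ne, HahnSeries.single_eq_zero_iff]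
  exact one_ne_zero

/-- A subspace that meets `H₋` trivially is closed. -/
theorem isClosed_of_inf_Hminus {W : Submodule ℂ H} (h : ∀ w ∈ W, w ∈ Hminus → w = 0) :
    IsClosed (W : Set H) := by
  have : DiscreteTopology W.toAddSubgroup := by
    refine discreteTopology_of_isOpen_singleton_zero ?_
    -- The trace of the open set `H₋` on `W` is `{0}`, so `W` is a discrete subgroup.
    convert isOpen_Hminus.preimage continuous_subtype_val using 1
    ext w
    rw [Set.mem_singleton_iff, Set.mem_preimage]
    refine ⟨?_, fun hw => Subtype.ext (h w w.2 hw)⟩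
    rintro rfl
    exact Hminus.zero_mem
  exact AddSubgroup.isClosed_of_discrete (H := W.toAddSubgroup)

/-- Closedness follows from the trivial kernel, so only the two algebraic conditions remain. -/
theorem mem_BigCell_iff {W : Submodule ℂ H} :
    W ∈ BigCell ↔ (∀ w ∈ W, w ∈ Hminus → w = 0) ∧ ∀ p : H, ∃ w ∈ W, w - p ∈ Hminus := by
  have hker : LinearMap.ker (piPlus.domRestrict W) = ⊥ ↔ ∀ w ∈ W, w ∈ Hminus → w = 0 := by
    rw [LinearMap.ker_eq_bot']
    have h0 : ∀ w : H, piPlus w = 0 ↔ w ∈ Hminus := fun w => by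
      rw [piPlus_eq_iff]
      simp
    refine ⟨fun h w hw hm => ?_, fun h w hw => Subtype.ext (h w w.2 ((h0 _).mp hw))⟩
    exact congrArg Subtype.val (h ⟨w, hw⟩ ((h0 w).mpr hm))
  have hrange : LinearMap.range (piPlus.domRestrict W) = ⊤ ↔
      ∀ p : H, ∃ w ∈ W, w - p ∈ Hminus := by
    rw [LinearMap.range_eq_top]
    refine ⟨fun h p => ?_, fun h p => ?_⟩
    · obtain ⟨w, hw⟩ := h (piPlus p)
      refine ⟨w, w.2, ?_⟩
      have h1 := Hminus.sub_mem (piPlus_eq_iff.mp hw) (sub_piPlus_mem p)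
      rwa [sub_sub_sub_cancel_right] at h1
    · obtain ⟨w, hw, h1⟩ := h p
      exact ⟨⟨w, hw⟩, piPlus_eq_iff.mpr h1⟩
  rw [BigCell, Set.mem_ofPred_eq, hker, hrange]
  exact ⟨fun h => h.2, fun h => ⟨isClosed_of_inf_Hminus h.1, h⟩⟩

theorem coe_apply_eq_add (G : DiffOp) (f : H) :
    (G : Module.End ℂ H) f = f + ((G - 1 : DiffOp) : Module.End ℂ H) f := by
  change _ = f + ((G : Module.End ℂ H) f - f)
  rw [add_sub_cancel]

/-- An element of `1 + 𝒟₋` maps `H₊` to a point of the big cell. -/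
theorem map_mem_BigCell {G : DiffOp} (hG : G ∈ SatoGroup) :
    Hplus.map (G : Module.End ℂ H) ∈ BigCell := by
  rw [mem_SatoGroup_iff] at hG
  rw [mem_BigCell_iff]
  constructor
  · rintro _ ⟨f, hf, rfl⟩ hm
    suffices h : ∀ d : ℕ, DegLt f d → f = 0 by
      obtain ⟨d, hd⟩ := exists_degLt f
      rw [h d hd, map_zero]
    intro d
    induction d with
    | zero => exact fun hd => eq_zero_of_mem hf hd
    | succ d ih =>
      intro hd
      -- `G - 1` lowers degrees, so `G · f` and `f` have the same coefficient of `z ^ d`; it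
      -- vanishes because `G · f ∈ H₋`.
      refine ih fun k hk => ?_
      rcases hk.eq_or_lt with rfl | hlt
      · have h1 := hm d (by omega)
        rw [coe_apply_eq_add, zCoeff_add, hG.degLt hd d (by push_cast; omega), add_zero] at h1
        exact h1
      · exact hd k (by push_cast; omega)
  · intro p
    obtain ⟨d, hd⟩ := exists_degLt p
    induction d generalizing p with
    | zero =>
      refine ⟨0, Submodule.zero_mem _, ?_⟩
      rw [zero_sub]
      exact Hminus.neg_mem hd
    | succ d ih =>
      set q := piPlus p with hq
      have hqd : DegLt (q : H) (d + 1 : ℕ) := fun k hk => by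
        have h1 := sub_piPlus_mem p k (by omega)
        rw [zCoeff_sub, hd k hk, zero_sub, neg_eq_zero] at h1
        exact h1
      -- Subtracting `G · q` removes the part of `p` in `H₊` at the cost of `(G - 1) · q`, which has
      -- lower degree.
      obtain ⟨w, hw, h⟩ := ih (p - (G : Module.End ℂ H) q) fun k hk => by
        have h1 := sub_piPlus_mem p k (by omega)
        rw [coe_apply_eq_add, ← sub_sub, zCoeff_sub, h1,
          hG.degLt hqd k (by push_cast; omega), sub_zero]
      refine ⟨w + (G : Module.End ℂ H) q,
        Submodule.add_mem _ hw (Submodule.mem_map_of_mem q.2), ?_⟩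
      rwa [sub_sub_eq_add_sub] at h

/-- Nested points of the big cell coincide. -/
theorem eq_of_le_of_mem_BigCell {V W : Submodule ℂ H} (hV : V ∈ BigCell) (hW : W ∈ BigCell)
    (h : V ≤ W) : V = W := by
  rw [mem_BigCell_iff] at hV hW
  refine le_antisymm h fun w hw => ?_
  obtain ⟨v, hv, hvw⟩ := hV.2 w
  rw [← sub_eq_zero.mp (hW.1 _ (W.sub_mem (h hv) hw) hvw)]
  exact hv

/-! ### Action on powers of `z` and vanishing criteria -/

theorem ddz_zpow (k : ℤ) : ddz (zpow k) = (k : ℂ) • zpow (k - 1) := by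
  refine H_ext fun l => ?_
  rw [zCoeff_ddz, zCoeff_smul, zCoeff_zpow, zCoeff_zpow]
  by_cases h : l + 1 = k
  · rw [if_pos h, if_pos (by omega), ← h]
    push_cast
    ring
  · rw [if_neg h, if_neg (by omega), mul_zero, mul_zero]

theorem zpow_zero_eq_one : zpow 0 = 1 := rfl

theorem eq_smul_one_of_ddz_eq_zero {f : H} (h : ddz f = 0) : f = zCoeff f 0 • (1 : H) := by
  refine H_ext fun k => ?_
  rw [zCoeff_smul, ← zpow_zero_eq_one, zCoeff_zpow]
  split_ifs with hk
  · rw [hk, mul_one]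
  · have h1 : zCoeff (ddz f) (k - 1) = 0 := by rw [h, zCoeff_zero]
    rw [zCoeff_ddz, sub_add_cancel] at h1
    have h2 : ((k - 1 : ℤ) : ℂ) + 1 ≠ 0 := by
      push_cast
      rw [sub_add_cancel]
      exact_mod_cast hk
    rw [mul_zero]
    exact (mul_eq_zero.mp h1).resolve_left h2

theorem ddz_pow_zpow (k m : ℕ) :
    (ddz ^ m) (zpow k) = (k.descFactorial m : ℂ) • zpow ((k : ℤ) - m) := by
  induction m with
  | zero => simp
  | succ m ih =>
    rw [pow_succ', Module.End.mul_apply, ih, map_smul, ddz_zpow, smul_smul,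
      Nat.descFactorial_succ]
    rcases le_or_gt m k with h | h
    · rw [Nat.cast_mul, mul_comm (((k - m : ℕ)) : ℂ), Nat.cast_sub h,
        show (k : ℤ) - m - 1 = k - (m + 1 : ℕ) by push_cast; ring]
      push_cast
      rfl
    · rw [Nat.descFactorial_of_lt h, mul_zero, Nat.cast_zero, zero_mul]
      rw [H_zero_smul, H_zero_smul]

/-- The action of an operator on `z ^ k` only involves its first `k + 1` coefficients. -/
theorem HasCoeffs.apply_zpow {A : DiffOp} {a : ℕ → H} (hA : HasCoeffs A a) (k : ℕ) :
    (A : Module.End ℂ H) (zpow k)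
      = ∑ m ∈ Finset.range k, a m * (ddz ^ m) (zpow k) + (k.factorial : ℂ) • a k := by
  obtain ⟨ha, hA⟩ := hA
  have htop : a k * (ddz ^ k) (zpow k) = (k.factorial : ℂ) • a k := by
    rw [ddz_pow_zpow, sub_self, zpow_zero_eq_one, Nat.descFactorial_self, mul_smul_H, mul_one]
  rw [← htop, ← Finset.sum_range_succ (fun m => a m * (ddz ^ m) (zpow k)), hA]
  ext n
  rw [seriesOp_coeff, HahnSeries.coeff_sum]
  refine finsum_eq_sum_of_support_subset _ fun m hm => ?_
  rw [Finset.coe_range, Set.mem_Iio]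
  by_contra hlt
  apply hm
  change (a m * (ddz ^ m) (zpow k)).coeff n = 0
  rw [ddz_pow_zpow, Nat.descFactorial_of_lt (by omega), Nat.cast_zero, mul_smul_H]
  exact zero_mul _

/-- An operator vanishes if each coefficient does as soon as the preceding ones do. -/
theorem HasCoeffs.eq_zero_of_step {A : DiffOp} {a : ℕ → H} (hA : HasCoeffs A a)
    (h : ∀ k, (∀ j < k, a j = 0) → (A : Module.End ℂ H) (zpow k) = (k.factorial : ℂ) • a k →
      a k = 0) : A = 0 := by
  have h0 : ∀ k, a k = 0 := fun k => by
    induction k using Nat.strong_induction_on with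
    | _ k ih =>
      refine h k ih ?_
      rw [hA.apply_zpow, Finset.sum_eq_zero, zero_add]
      intro m hm
      rw [ih m (Finset.mem_range.mp hm), zero_mul]
  obtain ⟨ha, hA⟩ := hA
  ext f n
  rw [hA, seriesOp_coeff, finsum_eq_zero_of_forall_eq_zero]
  · rfl
  · intro m
    rw [h0 m, zero_mul]
    rfl

theorem factorial_smul_cancel {k : ℕ} {f : H} {S : Submodule ℂ H}
    (h : (k.factorial : ℂ) • f ∈ S) : f ∈ S :=
  (S.smul_mem_iff (Nat.cast_ne_zero.mpr k.factorial_ne_zero)).mp h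

/-- The only element of `1 + 𝒟₋` preserving `H₊` is `1`. -/
theorem eq_one_of_map_le {G : DiffOp} (hG : G ∈ SatoGroup)
    (h : Hplus.map (G : Module.End ℂ H) ≤ Hplus) : G = 1 := by
  obtain ⟨a, hA, ham⟩ := hG
  rw [← sub_eq_zero]
  refine hA.eq_zero_of_step fun k _ hk => eq_zero_of_mem (factorial_smul_cancel (k := k) ?_) (ham k)
  have h1 := Hplus.sub_mem (h (Submodule.mem_map_of_mem (zpow_mem_Hplus k))) (zpow_mem_Hplus k)
  rwa [coe_apply_eq_add, add_sub_cancel_left, hk] at h1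

/-- An element of `𝒟₋` commuting with `∂` is zero. -/
theorem eq_zero_of_commute_dOp {B : DiffOp} (hB : B ∈ Dminus) (h : dOp * B = B * dOp) :
    B = 0 := by
  obtain ⟨a, hA, ham⟩ := hB
  refine hA.eq_zero_of_step fun k hj hk => ?_
  have h1 : ddz ((B : Module.End ℂ H) (zpow k)) = (B : Module.End ℂ H) (ddz (zpow k)) :=
    congrArg (fun T : DiffOp => (T : Module.End ℂ H) (zpow k)) h
  have h2 : (B : Module.End ℂ H) (ddz (zpow k)) = 0 := by
    rw [ddz_zpow, map_smul]
    cases k with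
    | zero => rw [Nat.cast_zero, Int.cast_zero, H_zero_smul]
    | succ k =>
      rw [show ((k + 1 : ℕ) : ℤ) - 1 = (k : ℕ) by push_cast; ring, hA.apply_zpow, hj k (by omega),
        Finset.sum_eq_zero fun m hm => by
          rw [hj m (by have := Finset.mem_range.mp hm; omega), zero_mul]]
      simp
  rw [h2, hk, map_smul] at h1
  have h3 := eq_zero_of_smul (Nat.cast_ne_zero.mpr k.factorial_ne_zero) h1
  rw [eq_smul_one_of_ddz_eq_zero h3, ham k 0 le_rfl, H_zero_smul]

/-! ### Sato's group element and the map `ρ` -/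

theorem coe_mul_apply (A B : DiffOp) (f : H) :
    ((A * B : DiffOp) : Module.End ℂ H) f = (A : Module.End ℂ H) ((B : Module.End ℂ H) f) := rfl

theorem coe_one_apply (f : H) : ((1 : DiffOp) : Module.End ℂ H) f = f := rfl

theorem zOp_pow_apply_one (k : ℕ) : ((zOp ^ k : DiffOp) : Module.End ℂ H) 1 = zpow k := by
  induction k with
  | zero => rfl
  | succ k ih =>
    rw [pow_succ', coe_mul_apply, ih]
    change zpow 1 * zpow k = _
    rw [zpow, zpow, zpow, HahnSeries.single_mul_single, mul_one]
    congr 2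
    push_cast
    ring

theorem map_coe_mul (A B : DiffOp) (V : Submodule ℂ H) :
    V.map ((A * B : DiffOp) : Module.End ℂ H)
      = (V.map (B : Module.End ℂ H)).map (A : Module.End ℂ H) :=
  Submodule.map_comp _ _ _

theorem map_coe_one (V : Submodule ℂ H) : V.map ((1 : DiffOp) : Module.End ℂ H) = V :=
  Submodule.map_id _

/-- `G'⁻¹ * G` lies in `1 + 𝒟₋` and preserves `H₊`, hence is `1`. -/
theorem IsSatoElement.unique {G G' : DiffOp} {W : Submodule ℂ H} (h : IsSatoElement G W)
    (h' : IsSatoElement G' W) : G = G' := by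
  obtain ⟨K, hK, h1, h2⟩ := exists_inverse h'.1
  have h3 : K * G = 1 := by
    refine eq_one_of_map_le (mul_mem_SatoGroup hK h.1) (le_of_eq ?_)
    rw [map_coe_mul, ← h.2, h'.2, ← map_coe_mul, h2, map_coe_one]
  calc G = G' * K * G := by rw [h1, one_mul]
    _ = G' := by rw [mul_assoc, h3, mul_one]

theorem exists_isSatoElement {W : Submodule ℂ H} (hW : W ∈ BigCell) :
    ∃ G, IsSatoElement G W := by
  choose σ hσW hσ using (mem_BigCell_iff.mp hW).2
  -- The sum `p = z ^ k + ∑ aⱼ ∂ʲ z ^ k` over `j < k` is already fixed, and `k! aₖ` is what remains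
  -- of `G · z ^ k`. It is chosen as `σ p - p`, in `H₋`, so that `G · z ^ k = σ p` lies in `W`.
  obtain ⟨a, ha⟩ := exists_strongRec fun k (ih : Fin k → H) =>
    (k.factorial : ℂ)⁻¹ • (σ (zpow k + ∑ j : Fin k, ih j * (ddz ^ (j : ℕ)) (zpow k))
      - (zpow k + ∑ j : Fin k, ih j * (ddz ^ (j : ℕ)) (zpow k)))
  have hm : ∀ k, a k ∈ Hminus := fun k => by
    rw [ha k]
    exact Hminus.smul_mem _ (hσ _)
  have hdeg : ∃ N, DegLE a N := ⟨-1, degLE_neg_one_iff.mpr hm⟩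
  let A : DiffOp := ⟨seriesOp a hdeg, a, hdeg, rfl⟩
  have hA : HasCoeffs A a := ⟨hdeg, rfl⟩
  have hG : 1 + A ∈ SatoGroup := ⟨a, by rwa [add_sub_cancel_left], hm⟩
  refine ⟨1 + A, hG, (eq_of_le_of_mem_BigCell (map_mem_BigCell hG) hW ?_).symm⟩
  rw [Submodule.map_le_iff_le_comap, ← span_zpow, Submodule.span_le]
  rintro _ ⟨k, rfl⟩
  change zpow k + (A : Module.End ℂ H) (zpow k) ∈ W
  have h := ha k
  rw [Fin.sum_univ_eq_sum_range (fun j => a j * (ddz ^ j) (zpow k))] at h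
  rw [hA.apply_zpow, h, smul_inv_smul₀ (Nat.cast_ne_zero.mpr k.factorial_ne_zero), ← add_assoc,
    add_sub_cancel]
  exact hσW _

theorem IsSatoElement.satoElement_eq {G : DiffOp} {W : Submodule ℂ H} (h : IsSatoElement G W) :
    satoElement W = G := by
  have hex : ∃ G, IsSatoElement G W := ⟨G, h⟩
  rw [satoElement, dif_pos hex]
  exact hex.choose_spec.unique h

theorem IsSatoElement.rho_eq {G K : DiffOp} {W : Submodule ℂ H} (h : IsSatoElement G W)
    (h1 : G * K = 1) (h2 : K * G = 1) : rho W = (G * dOp * K, G * zOp * K) := by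
  have hK : Ring.inverse G = K := Ring.inverse_unit (⟨G, K, h1, h2⟩ : DiffOpˣ)
  rw [rho, h.satoElement_eq, hK]

theorem dOp_zOp_comm : dOp * zOp - zOp * dOp = 1 := by
  ext f n
  change (ddz (zpow 1 * f)).coeff n - (zpow 1 * ddz f).coeff n = f.coeff n
  rw [ddz_coeff, zpow, HahnSeries.coeff_single_mul, HahnSeries.coeff_single_mul, ddz_coeff]
  push_cast
  rw [show n - 1 - -1 = n by ring, show n - -1 - 1 = n by ring]
  ring

theorem rho_mem_GrD {W : Submodule ℂ H} (hW : W ∈ BigCell) : rho W ∈ GrD := by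
  obtain ⟨G, hG⟩ := exists_isSatoElement hW
  obtain ⟨K, hK, h1, h2⟩ := exists_inverse hG.1
  have hA := mem_SatoGroup_iff.mp hG.1
  have hK0 := ordLE_zero_of_mem hK
  rw [hG.rho_eq h1 h2]
  refine ⟨?_, exists_zInvOp_mul_iff.mpr ?_, mem_Dminus_iff.mpr ?_⟩
  · calc G * dOp * K * (G * zOp * K) - G * zOp * K * (G * dOp * K)
        = G * dOp * (K * G) * zOp * K - G * zOp * (K * G) * dOp * K := by noncomm_ring
      _ = G * (dOp * zOp - zOp * dOp) * K := by
        rw [h2]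
        noncomm_ring
      _ = 1 := by rw [dOp_zOp_comm, mul_one, h1]
  -- Since `G * K = 1`, the difference is `-[∂, G - 1] * K`, and the commutator lowers the order
  -- from `-1` to `-2`.
  · have : G * dOp * K - dOp = -(dOp * (G - 1) - (G - 1) * dOp) * K + dOp * (G * K - 1) := by
      noncomm_ring
    change OrdLE (G * dOp * K - dOp) (-2)
    rw [this, h1, sub_self, mul_zero, add_zero]
    exact hA.comm_dOp.neg.mul hK0
  · have : G * zOp * K - zOp = ((G - 1) * zOp - zOp * (G - 1)) * K + zOp * (G * K - 1) := by
      noncomm_ring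
    change OrdLE (G * zOp * K - zOp) (-1)
    rw [this, h1, sub_self, mul_zero, add_zero]
    exact hA.comm_zOp.mul hK0

/-! ### Conjugation to `(∂, z)` -/

/-- Every pair in `Gr_𝒟` is conjugate to `(∂, z)` by an element of `1 + 𝒟₋`. -/
theorem exists_conjugation {P Q : DiffOp} (h : (P, Q) ∈ GrD) :
    ∃ G ∈ SatoGroup, P * G = G * dOp ∧ Q * G = G * zOp := by
  obtain ⟨hc, hP, hQ⟩ := h
  simp only at hc hP hQ
  obtain ⟨G, hG, hPG⟩ := exists_dressing (exists_zInvOp_mul_iff.mp hP)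
  rw [add_sub_cancel] at hPG
  obtain ⟨K, hK, h1, h2⟩ := exists_inverse hG
  have hd : dOp = K * P * G := by rw [mul_assoc, hPG, ← mul_assoc, h2, one_mul]
  -- Conjugating `[P, Q] = 1` gives `[∂, K * Q * G] = 1 = [∂, z]`, so this element of `𝒟₋` commutes
  -- with `∂`.
  have hB : K * Q * G - zOp = 0 := by
    refine eq_zero_of_commute_dOp (mem_Dminus_iff.mpr ?_) ?_
    · have : K * Q * G - zOp
          = K * ((Q - zOp) * G + -((G - 1) * zOp - zOp * (G - 1))) + (K * G - 1) * zOp := by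
        noncomm_ring
      rw [this, h2, sub_self, zero_mul, add_zero, ← zero_add (-1)]
      exact (ordLE_zero_of_mem hK).mul
        (((mem_Dminus_iff.mp hQ).mul (ordLE_zero_of_mem hG)).add
          (mem_SatoGroup_iff.mp hG).comm_zOp.neg)
    · rw [← sub_eq_zero]
      calc dOp * (K * Q * G - zOp) - (K * Q * G - zOp) * dOp
          = dOp * (K * Q * G) - (K * Q * G) * dOp - (dOp * zOp - zOp * dOp) := by noncomm_ring
        _ = K * P * G * (K * Q * G) - (K * Q * G) * (K * P * G) - 1 := by
          rw [dOp_zOp_comm, ← hd]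
        _ = K * P * (G * K) * Q * G - K * Q * (G * K) * P * G - 1 := by noncomm_ring
        _ = K * (P * Q - Q * P) * G - 1 := by
          rw [h1]
          noncomm_ring
        _ = 0 := by rw [hc, mul_one, h2, sub_self]
  refine ⟨G, hG, hPG, ?_⟩
  rw [← sub_eq_zero.mp hB, ← mul_assoc, ← mul_assoc, h1, one_mul]

theorem rho_map_eq {P Q G : DiffOp} (hG : G ∈ SatoGroup) (hP : P * G = G * dOp)
    (hQ : Q * G = G * zOp) : rho (Hplus.map (G : Module.End ℂ H)) = (P, Q) := by
  obtain ⟨K, hK, h1, h2⟩ := exists_inverse hG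
  rw [IsSatoElement.rho_eq ⟨hG, rfl⟩ h1 h2, ← hP, ← hQ, mul_assoc, mul_assoc, h1, mul_one, mul_one]

/-! ### The inverse map -/

/-- A conjugation of `(P, Q)` to `(∂, z)` maps `H₊` to the span of `Ψ, Q · Ψ, Q² · Ψ, …`. -/
theorem spanOf_eq_map {Q G : DiffOp} (hQ : Q * G = G * zOp) :
    spanOf Q ((G : Module.End ℂ H) 1) = Hplus.map (G : Module.End ℂ H) := by
  have hpow : ∀ k : ℕ, ((Q ^ k : DiffOp) : Module.End ℂ H) ((G : Module.End ℂ H) 1)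
      = (G : Module.End ℂ H) (zpow k) := fun k => by
    have h : SemiconjBy G zOp Q := hQ.symm
    rw [← coe_mul_apply, ← (h.pow_right k).eq, coe_mul_apply, zOp_pow_apply_one]
  rw [spanOf, ← span_zpow, Submodule.map_span, ← Set.range_comp]
  exact congrArg _ (congrArg _ (funext hpow))

theorem zCoeff_apply_one {G : DiffOp} (hG : G ∈ SatoGroup) :
    zCoeff ((G : Module.End ℂ H) 1) 0 = 1 ∧ DegLt ((G : Module.End ℂ H) 1) 1 := by
  have h1 : DegLt (1 : H) 1 := fun k hk => by
    rw [← zpow_zero_eq_one, zCoeff_zpow, if_neg (by omega)]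
  have h2 := (mem_SatoGroup_iff.mp hG).degLt h1
  rw [coe_apply_eq_add]
  refine ⟨?_, fun k hk => ?_⟩
  · rw [zCoeff_add, h2 0 (by omega), ← zpow_zero_eq_one, zCoeff_zpow, if_pos rfl, add_zero]
  · rw [zCoeff_add, h1 k hk, h2 k (by omega), add_zero]

theorem apply_one_mem_ker {P G : DiffOp} (hP : P * G = G * dOp) :
    (P : Module.End ℂ H) ((G : Module.End ℂ H) 1) = 0 := by
  rw [← coe_mul_apply, hP, coe_mul_apply]
  change (G : Module.End ℂ H) (ddz 1) = 0
  rw [← zpow_zero_eq_one, ddz_zpow, Int.cast_zero, H_zero_smul, map_zero]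

/-- Conjugation carries the kernel of `P` to that of `∂`, the constants, so the kernel of `P` is the
line through `G · 1`. Being monic fixes the multiple. -/
theorem eq_apply_one_of_isMonic {P G : DiffOp} (hG : G ∈ SatoGroup) (hP : P * G = G * dOp)
    {Ψ : H} (hm : IsMonic Ψ) (h : (P : Module.End ℂ H) Ψ = 0) :
    Ψ = (G : Module.End ℂ H) 1 := by
  obtain ⟨K, hK, h1, h2⟩ := exists_inverse hG
  have h3 : ddz ((K : Module.End ℂ H) Ψ) = 0 := by
    have : dOp * K = K * P := by
      calc dOp * K = K * (G * dOp) * K := by rw [← mul_assoc K, h2, one_mul]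
        _ = K * P := by rw [← hP, mul_assoc, mul_assoc, h1, mul_one]
    change (dOp : Module.End ℂ H) _ = 0
    rw [← coe_mul_apply, this, coe_mul_apply, h, map_zero]
  have h4 : Ψ = zCoeff ((K : Module.End ℂ H) Ψ) 0 • (G : Module.End ℂ H) 1 := by
    rw [← map_smul, ← eq_smul_one_of_ddz_eq_zero h3, ← coe_mul_apply, h1, coe_one_apply]
  generalize zCoeff ((K : Module.End ℂ H) Ψ) 0 = c at h4
  obtain ⟨hc0, hc1⟩ := zCoeff_apply_one hG
  obtain ⟨d, hd, hd'⟩ := hm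
  suffices c = 1 by rw [h4, this, one_smul]
  have hΨ0 : zCoeff Ψ 0 = c := by rw [h4, zCoeff_smul, hc0, mul_one]
  -- `Ψ = c • (G · 1)` and `G · 1` has leading term `z ^ 0`: for `d < 0` this gives `c = 0`, and for
  -- `d > 0` the coefficient of `z ^ d` vanishes, both contradicting monicity.
  rcases lt_trichotomy d 0 with hlt | rfl | hlt
  · rw [hd' 0 hlt] at hΨ0
    rw [h4, ← hΨ0, zCoeff_smul, zero_mul] at hd
    exact (zero_ne_one hd).elim
  · rw [← hΨ0, hd]
  · rw [h4, zCoeff_smul, hc1 d (by omega), mul_zero] at hd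
    exact (zero_ne_one hd).elim

/-- The pair determines `W`: `P` determines `Ψ = G · 1` as its monic kernel element, and `W` is the
span of the `Q ^ k · Ψ`. -/
theorem rho_injOn : Set.InjOn rho BigCell := by
  intro W hW W' hW' h
  obtain ⟨G, hG⟩ := exists_isSatoElement hW
  obtain ⟨G', hG'⟩ := exists_isSatoElement hW'
  obtain ⟨K, -, h1, h2⟩ := exists_inverse hG.1
  obtain ⟨K', -, h1', h2'⟩ := exists_inverse hG'.1
  rw [hG.rho_eq h1 h2, hG'.rho_eq h1' h2', Prod.mk.injEq] at h
  have hz : G * zOp * K * G = G * zOp := by rw [mul_assoc, h2, mul_one]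
  have hz' : G * zOp * K * G' = G' * zOp := by rw [h.2, mul_assoc, h2', mul_one]
  have hd : G * dOp * K * G = G * dOp := by rw [mul_assoc, h2, mul_one]
  have hd' : G * dOp * K * G' = G' * dOp := by rw [h.1, mul_assoc, h2', mul_one]
  have h0 : (G' : Module.End ℂ H) 1 = (G : Module.End ℂ H) 1 := by
    refine eq_apply_one_of_isMonic hG.1 hd ⟨0, ?_⟩ ?_
    · obtain ⟨h3, h4⟩ := zCoeff_apply_one hG'.1
      exact ⟨h3, fun k hk => h4 k (by omega)⟩
    · exact apply_one_mem_ker hd'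
  rw [hG.2, hG'.2, ← spanOf_eq_map hz, ← spanOf_eq_map hz', h0]

end SatoKS

end

theorem theorem1p1 :
    -- every point of the big cell has exactly one Sato group element, and it is invertible
    (∀ W ∈ SatoKS.BigCell, ∃! G : SatoKS.DiffOp, SatoKS.IsSatoElement G W) ∧
    (∀ G ∈ SatoKS.SatoGroup, IsUnit G) ∧
    -- the map is a bijection
    Set.BijOn SatoKS.rho SatoKS.BigCell SatoKS.GrD ∧
    -- description of the inverse map
    (∀ P Q : SatoKS.DiffOp, (P, Q) ∈ SatoKS.GrD →
      ∃ Ψ : SatoKS.H,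
        (SatoKS.IsMonic Ψ ∧ (P : Module.End ℂ SatoKS.H) Ψ = 0) ∧
        (∀ Ψ' : SatoKS.H,
          SatoKS.IsMonic Ψ' → (P : Module.End ℂ SatoKS.H) Ψ' = 0 → Ψ' = Ψ) ∧
        SatoKS.spanOf Q Ψ ∈ SatoKS.BigCell ∧
        SatoKS.rho (SatoKS.spanOf Q Ψ) = (P, Q)) := by
  open SatoKS in
  refine ⟨fun W hW => ?_, fun G hG => ?_, ⟨fun W hW => rho_mem_GrD hW, rho_injOn, ?_⟩, ?_⟩
  · obtain ⟨G, hG⟩ := exists_isSatoElement hW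
    exact ⟨G, hG, fun G' hG' => hG'.unique hG⟩
  · obtain ⟨K, -, h1, h2⟩ := exists_inverse hG
    exact ⟨⟨G, K, h1, h2⟩, rfl⟩
  · rintro ⟨P, Q⟩ h
    obtain ⟨G, hG, hP, hQ⟩ := exists_conjugation h
    exact ⟨_, map_mem_BigCell hG, rho_map_eq hG hP hQ⟩
  · intro P Q h
    obtain ⟨G, hG, hP, hQ⟩ := exists_conjugation h
    obtain ⟨h0, h1⟩ := zCoeff_apply_one hG
    refine ⟨(G : Module.End ℂ H) 1, ⟨⟨0, h0, fun k hk => h1 k (by omega)⟩, ?_⟩,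
      fun Ψ' hm hΨ => eq_apply_one_of_isMonic hG hP hm hΨ, ?_, ?_⟩
    · exact apply_one_mem_ker hP
    · rw [spanOf_eq_map hQ]
      exact map_mem_BigCell hG
    · rw [spanOf_eq_map hQ]
      exact rho_map_eq hG hP hQ
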